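/- Let $a>b>0$ and $\varepsilon_0>0$, and put $r^2=a^2-b^2$. Let $$\mathcal P^6=\{(\mathbf M,\boldsymbol\alpha,\boldsymbol\beta)\in\mathbb R^3\times\mathbb R^3\times\mathbb R^3:\ \boldsymbol\alpha\cdot\boldsymbol\alpha=a^2,\ \boldsymbol\beta\cdot\boldsymbol\beta=b^2,\ \boldsymbol\alpha\cdot\boldsymbol\beta=0\}$$ be the phase space of the generalized two-field gyrostat with zero gyrostatic momentum. On $\mathcal P^6$ put $$x_{1,2}=(\alpha_1-\beta_2)\pm i(\alpha_2+\beta_1),\quad z_{1,2}=\alpha_3\pm i\beta_3,\quad w_{1,2}=\tfrac12(M_1\pm iM_2),\quad w_3=M_3,$$ and, for $\varepsilon_1\in\mathbb R$, $$\xi_1=w_1^2+\varepsilon_0x_1-i\varepsilon_1(x_1w_3-2z_1w_1)-\varepsilon_1^2r^2,\qquad \xi_2=w_2^2+\varepsilon_0x_2+i\varepsilon_1(x_2w_3-2z_2w_2)-\varepsilon_1^2r^2.$$ Where $x_1x_2\neq0$, let $$F=\sqrt{x_1x_2}\,w_3-\frac{x_2z_1w_1+x_1z_2w_2}{\sqrt{x_1x_2}}+i\varepsilon_1r^2\,\frac{x_1-x_2}{\sqrt{x_1x_2}},\qquad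 F_1=\frac{x_2}{x_1}\xi_1-\frac{x_1}{x_2}\xi_2,$$ and let $\mathfrak M_2$ be the closure of the set $\{x_1x_2\ne0,\ F=0,\ F_1=0\}\subset\mathcal P^6$. Then there is $\delta>0$, depending only on $a,b,\varepsilon_0$, such that for every real $\varepsilon_1$ with $|\varepsilon_1|<\delta$ the set $\mathfrak M_2$ is a (nonempty) smooth 4-dimensional manifold, namely an embedded $C^\infty$ submanifold of $\mathbb R^9$ contained in $\mathcal P^6$. -/

import Mathlib

open scoped ContDiff

namespace GTFG

/-- A subset `S` of a normed space is a smooth `k`-dimensional (embedded) submanifold if every point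
of `S` has a neighbourhood `S ∩ U` in `S` which is diffeomorphic to an open subset `V` of `ℝᵏ`:
`φ` is a smooth parametrization of `S ∩ U` by `V`, and its inverse is the restriction to `S ∩ U` of
a smooth map `ψ` defined on the open set `U`. -/
def IsSmoothSubmanifold {E : Type*} [NormedAddCommGroup E] [NormedSpace ℝ E]
    (k : ℕ) (S : Set E) : Prop :=
  ∀ q ∈ S, ∃ (U : Set E) (V : Set (Fin k → ℝ)) (φ : (Fin k → ℝ) → E) (ψ : E → (Fin k → ℝ)),
    IsOpen U ∧ q ∈ U ∧ IsOpen V ∧ ContDiffOn ℝ ∞ φ V ∧ ContDiffOn ℝ ∞ ψ U ∧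
      φ '' V = S ∩ U ∧ ∀ v ∈ V, ψ (φ v) = v

/-- The space `ℝ⁹` of triples `(M, α, β)` of vectors in `ℝ³`. -/
abbrev V9 : Type := (Fin 3 → ℝ) × (Fin 3 → ℝ) × (Fin 3 → ℝ)

/-- The kinetic momentum `M`. -/
def mom (q : V9) : Fin 3 → ℝ := q.1

/-- The first field `α`. -/
def al (q : V9) : Fin 3 → ℝ := q.2.1

/-- The second field `β`. -/
def be (q : V9) : Fin 3 → ℝ := q.2.2

/-- The phase space: orthogonal fields `α`, `β` of intensities `a`, `b`. -/
def P6 (a b : ℝ) : Set V9 :=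
  {q | al q ⬝ᵥ al q = a ^ 2 ∧ be q ⬝ᵥ be q = b ^ 2 ∧ al q ⬝ᵥ be q = 0}

noncomputable section

/-! The complex variables, with vector components indexed from `0`. -/

def x₁ (q : V9) : ℂ := (al q 0 - be q 1) + Complex.I * (al q 1 + be q 0)

def x₂ (q : V9) : ℂ := (al q 0 - be q 1) - Complex.I * (al q 1 + be q 0)

def z₁ (q : V9) : ℂ := al q 2 + Complex.I * be q 2

def z₂ (q : V9) : ℂ := al q 2 - Complex.I * be q 2

def w₁ (q : V9) : ℂ := (mom q 0 + Complex.I * mom q 1) / 2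

def w₂ (q : V9) : ℂ := (mom q 0 - Complex.I * mom q 1) / 2

/-- `w₃ = M₃ - λ` with zero gyrostatic momentum `λ = 0`. -/
def w₃ (q : V9) : ℂ := mom q 2

/-- `√(x₁ x₂)`; the number `x₁ x₂` is real and nonnegative. -/
def sqrtX (q : V9) : ℂ := (Real.sqrt (x₁ q * x₂ q).re : ℝ)

/-- `r² = a² - b²`. -/
def rSq (a b : ℝ) : ℂ := ((a ^ 2 - b ^ 2 : ℝ) : ℂ)

def ξ₁ (a b ε₀ ε₁ : ℝ) (q : V9) : ℂ :=
  w₁ q ^ 2 + ε₀ * x₁ q - Complex.I * ε₁ * (x₁ q * w₃ q - 2 * z₁ q * w₁ q) - ε₁ ^ 2 * rSq a b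

def ξ₂ (a b ε₀ ε₁ : ℝ) (q : V9) : ℂ :=
  w₂ q ^ 2 + ε₀ * x₂ q + Complex.I * ε₁ * (x₂ q * w₃ q - 2 * z₂ q * w₂ q) - ε₁ ^ 2 * rSq a b

def F (a b ε₁ : ℝ) (q : V9) : ℂ :=
  sqrtX q * w₃ q - (x₂ q * z₁ q * w₁ q + x₁ q * z₂ q * w₂ q) / sqrtX q
    + Complex.I * ε₁ * rSq a b * ((x₁ q - x₂ q) / sqrtX q)

def F₁ (a b ε₀ ε₁ : ℝ) (q : V9) : ℂ :=
  x₂ q / x₁ q * ξ₁ a b ε₀ ε₁ q - x₁ q / x₂ q * ξ₂ a b ε₀ ε₁ q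

/-- The critical set: the closure of `{F = 0, F₁ = 0}`, where `F`, `F₁` are functions on the part
`x₁ x₂ ≠ 0` of the phase space. (The phase space is closed in `ℝ⁹`.) -/
def M2 (a b ε₀ ε₁ : ℝ) : Set V9 :=
  closure {q | q ∈ P6 a b ∧ x₁ q * x₂ q ≠ 0 ∧ F a b ε₁ q = 0 ∧ F₁ a b ε₀ ε₁ q = 0}

end

end GTFG

namespace GTFG

noncomputable section

open Module Topology

/-! Put f = α + iβ, x₁ = f₁ + i f₂, y = f₁ - i f₂, z₁ = f₃. The phase space becomes x₁ y + z₁² = r²,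
|x₁|² + |y|² + 2|z₁|² = 2(a² + b²). Where x₁ ≠ 0, these equations give y in terms of x₁ and z₁, and
F = 0 gives M₃. What remains is the zero set in ℝ⁶ of two functions with independent differentials
(`surjective_fderiv_regularEqs`), of dimension 4.

At x₁ = 0 the cleared equations degenerate, so x₁ = λ exp(iθ) is blown up. Modulo the other
equations a power of λ splits off F₁ = 0 (`blowFns_reduction`), leaving five equations in ℝ⁹. On λ =
0 they are independent, even together with λ (`surjective_fderiv_blowFns`), so the blown-up set is
smooth of dimension 4 there and its points with λ = 0 are limits of points with λ ≠ 0
(`blowPoint_mem_M2`). Blowing down keeps the set embedded: over a point with x₁ = 0 the direction is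
unique up to sign (`isBlowUp_angle_unique`), the map is an immersion
(`fderiv_blowPoint_injective_on_ker`), and it is proper because the angle ranges over a compact
interval.

The smallness of ε₁ enters only as 2aε₁² < ε₀. Near x₁ = 0 it keeps η = ε₀ - iε₁M₃ - ε₁²y away from
zero, since |y| ≤ 2a. -/

/-! ### Charts from level sets of submersions -/

/-- `B` is injective on ker `A`, so a left inverse of its restriction, followed by an isomorphism
ker `A` ≅ ℝᵏ, serves as `C`; equality of dimensions does the rest. -/
theorem exists_complementary_functional {X Y E : Type*}
    [NormedAddCommGroup X] [NormedSpace ℝ X] [FiniteDimensional ℝ X]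
    [NormedAddCommGroup Y] [NormedSpace ℝ Y] [FiniteDimensional ℝ Y]
    [NormedAddCommGroup E] [NormedSpace ℝ E] [FiniteDimensional ℝ E] {k : ℕ}
    (A : X →L[ℝ] Y) (B : X →L[ℝ] E) (hA : Function.Surjective A)
    (hinj : ∀ v, A v = 0 → B v = 0 → v = 0) (hdim : finrank ℝ X = finrank ℝ Y + k) :
    ∃ (C : E →L[ℝ] (Fin k → ℝ)) (e : X ≃L[ℝ] Y × (Fin k → ℝ)),
      (e : X →L[ℝ] Y × (Fin k → ℝ)) = A.prod (C.comp B) := by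
  set T := LinearMap.ker (A : X →ₗ[ℝ] Y) with hT
  have hTk : finrank ℝ T = finrank ℝ (Fin k → ℝ) := by
    have h1 := LinearMap.finrank_range_add_finrank_ker (A : X →ₗ[ℝ] Y)
    have h2 : LinearMap.range (A : X →ₗ[ℝ] Y) = ⊤ := LinearMap.range_eq_top.2 hA
    rw [h2, finrank_top] at h1
    change _ + finrank ℝ T = _ at h1
    simp only [finrank_fin_fun]
    omega
  have hf : LinearMap.ker ((B : X →ₗ[ℝ] E).comp T.subtype) = ⊥ := by
    rw [LinearMap.ker_eq_bot']
    rintro ⟨v, hv⟩ h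
    exact Subtype.ext (hinj v hv h)
  obtain ⟨g, hg⟩ := LinearMap.exists_leftInverse_of_injective _ hf
  let i : T ≃ₗ[ℝ] (Fin k → ℝ) := LinearEquiv.ofFinrankEq _ _ hTk
  let C : E →L[ℝ] (Fin k → ℝ) := LinearMap.toContinuousLinearMap (i.toLinearMap.comp g)
  have hinj' : Function.Injective (A.prod (C.comp B)).toLinearMap := by
    rw [← LinearMap.ker_eq_bot, LinearMap.ker_eq_bot']
    intro v hv
    have h1 : A v = 0 := congrArg Prod.fst hv
    have h2 : i (g (B v)) = 0 := congrArg Prod.snd hv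
    have h3 : g (B v) = (⟨v, h1⟩ : T) := LinearMap.congr_fun hg ⟨v, h1⟩
    rw [h3] at h2
    exact congrArg Subtype.val ((LinearEquiv.map_eq_zero_iff i).1 h2)
  have hd : finrank ℝ X = finrank ℝ (Y × (Fin k → ℝ)) := by
    rw [finrank_prod, finrank_fin_fun, hdim]
  refine ⟨C, (LinearEquiv.ofInjectiveOfFinrankEq _ hinj' hd).toContinuousLinearEquiv, ?_⟩
  ext v : 1
  rfl

/-- A set which near `Ψ p` is the bijective image under `Ψ` of a level set of a submersion `G` has
a smooth chart at `Ψ p`, provided that `Ψ` is an immersion of the level set at `p`. -/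
theorem exists_chart_of_levelSet {X Y E : Type*}
    [NormedAddCommGroup X] [NormedSpace ℝ X] [FiniteDimensional ℝ X]
    [NormedAddCommGroup Y] [NormedSpace ℝ Y] [FiniteDimensional ℝ Y]
    [NormedAddCommGroup E] [NormedSpace ℝ E] [FiniteDimensional ℝ E] {k : ℕ}
    {S : Set E} {G : X → Y} {Ψ : X → E} {p : X} {O : Set X} (hO : IsOpen O) (hp : p ∈ O)
    (hG : ContDiffOn ℝ ∞ G O) (hΨ : ContDiffOn ℝ ∞ Ψ O)
    (hsurj : Function.Surjective (fderiv ℝ G p))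
    (hinj : ∀ v, fderiv ℝ G p v = 0 → fderiv ℝ Ψ p v = 0 → v = 0)
    (hdim : finrank ℝ X = finrank ℝ Y + k)
    (hS : ∀ t ∈ O, G t = 0 → Ψ t ∈ S)
    (hS' : ∀ O' ∈ 𝓝 p, ∃ U ∈ 𝓝 (Ψ p), S ∩ U ⊆ Ψ '' (O' ∩ G ⁻¹' {0})) :
    ∃ (U : Set E) (V : Set (Fin k → ℝ)) (φ : (Fin k → ℝ) → E) (ψ : E → (Fin k → ℝ)),
      IsOpen U ∧ Ψ p ∈ U ∧ IsOpen V ∧ ContDiffOn ℝ ∞ φ V ∧ ContDiffOn ℝ ∞ ψ U ∧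
      φ '' V = S ∩ U ∧ ∀ v ∈ V, ψ (φ v) = v := by
  obtain ⟨C, e, he⟩ := exists_complementary_functional _ _ hsurj hinj hdim
  -- `Φ` is a local diffeomorphism at `p`. It straightens the level set to 0 × ℝᵏ, and the inverse
  -- chart is the linear map `C` itself.
  set Φ : X → Y × (Fin k → ℝ) := fun t => (G t, C (Ψ t)) with hΦ
  have hΦc : ContDiffOn ℝ ∞ Φ O := hG.prodMk (C.contDiff.comp_contDiffOn hΨ)
  have hGd := (hG.contDiffAt (hO.mem_nhds hp)).differentiableAt (by simp)
  have hΨd := (hΨ.contDiffAt (hO.mem_nhds hp)).differentiableAt (by simp)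
  have hΦ' : HasFDerivAt Φ (e : X →L[ℝ] Y × (Fin k → ℝ)) p := by
    rw [he]
    exact hGd.hasFDerivAt.prodMk (C.hasFDerivAt.comp p hΨd.hasFDerivAt)
  have hcat : ContDiffAt ℝ ∞ Φ p := hΦc.contDiffAt (hO.mem_nhds hp)
  set T := hcat.toOpenPartialHomeomorph Φ hΦ' (by simp) with hT
  have hTΦ : ∀ t, T t = Φ t := fun t => rfl
  have hpT : p ∈ T.source := hcat.mem_toOpenPartialHomeomorph_source hΦ' (by simp)
  -- The local inverse is known to be smooth only where the derivative of `Φ` is invertible, so the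
  -- source is shrunk to such points.
  have hinv : IsOpen (O ∩ fderiv ℝ Φ ⁻¹'
      Set.range ((↑) : (X ≃L[ℝ] Y × (Fin k → ℝ)) → (X →L[ℝ] Y × (Fin k → ℝ)))) :=
    (hΦc.continuousOn_fderiv_of_isOpen hO (by simp)).isOpen_inter_preimage hO
      (ContinuousLinearEquiv.isOpen)
  set O' := T.source ∩ (O ∩ fderiv ℝ Φ ⁻¹'
      Set.range ((↑) : (X ≃L[ℝ] Y × (Fin k → ℝ)) → (X →L[ℝ] Y × (Fin k → ℝ)))) with hO'
  have hO'o : IsOpen O' := T.open_source.inter hinv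
  have hpO' : p ∈ O' := ⟨hpT, hp, e, hΦ'.fderiv.symm⟩
  obtain ⟨U₀, hU₀, hSU⟩ := hS' O' (hO'o.mem_nhds hpO')
  obtain ⟨U, hUU, hUo, hpU⟩ := mem_nhds_iff.1 hU₀
  have hW : IsOpen (O' ∩ Ψ ⁻¹' U) :=
    (hΨ.continuousOn.mono fun t ht => ht.2.1).isOpen_inter_preimage hO'o hUo
  have hVo := (T.symm.isOpen_inter_preimage hW).preimage
    (f := fun v : Fin k → ℝ => ((0 : Y), v)) (by fun_prop)
  refine ⟨U, _, fun v => Ψ (T.symm (0, v)), C, hUo, hpU, hVo, ?_, C.contDiff.contDiffOn, ?_, ?_⟩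
  · rintro v ⟨hv, ⟨hs, hvO, i, hi⟩, -⟩
    have h1 : HasFDerivAt T (i : X →L[ℝ] Y × (Fin k → ℝ)) (T.symm (0, v)) := by
      have := ((hΦc.contDiffAt (hO.mem_nhds hvO)).differentiableAt (by simp)).hasFDerivAt
      rw [← hi] at this
      exact this
    have h2 : ContDiffAt ℝ ∞ T.symm ((0 : Y), v) :=
      T.contDiffAt_symm hv h1 (hΦc.contDiffAt (hO.mem_nhds hvO))
    have h3 : ContDiffAt ℝ ∞ (fun v : Fin k → ℝ => ((0 : Y), v)) v := by fun_prop
    exact ((hΨ.contDiffAt (hO.mem_nhds hvO)).comp v (h2.comp v h3)).contDiffWithinAt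
  · apply Set.Subset.antisymm
    · rintro _ ⟨v, ⟨hv, ⟨hs, hvO, -⟩, hvU⟩, rfl⟩
      have h1 : Φ (T.symm (0, v)) = (0, v) := T.right_inv hv
      exact ⟨hS _ hvO (congrArg Prod.fst h1), hvU⟩
    · rintro y ⟨hyS, hyU⟩
      obtain ⟨t, ⟨htO, ht0⟩, rfl⟩ := hSU ⟨hyS, hUU hyU⟩
      have h1 : T t = (0, C (Ψ t)) := Prod.ext ht0 rfl
      have h2 : T.symm (0, C (Ψ t)) = t := by rw [← h1]; exact T.left_inv htO.1
      refine ⟨C (Ψ t), ⟨?_, ?_⟩, ?_⟩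
      · change (0, C (Ψ t)) ∈ T.target
        rw [← h1]; exact T.map_source htO.1
      · change T.symm (0, C (Ψ t)) ∈ O' ∩ Ψ ⁻¹' U
        rw [h2]; exact ⟨htO, hyU⟩
      · change Ψ (T.symm (0, C (Ψ t))) = Ψ t
        rw [h2]
  · rintro v ⟨hv, -⟩
    have h1 : Φ (T.symm (0, v)) = (0, v) := T.right_inv hv
    exact congrArg Prod.snd h1

/-! Real coordinates: `x₁ = xRe + i xIm`, and `yRe + i yIm` is the remaining complex combination
of the fields, so that the phase space is given by `x₁ y + z₁² = r²` and
`|x₁|² + |y|² + 2 |z₁|² = 2 (a² + b²)`. -/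

def xRe (q : V9) : ℝ := al q 0 - be q 1

def xIm (q : V9) : ℝ := al q 1 + be q 0

def yRe (q : V9) : ℝ := al q 0 + be q 1

def yIm (q : V9) : ℝ := be q 0 - al q 1

/-- The squared modulus of `x₁`. -/
def xNormSq (q : V9) : ℝ := xRe q ^ 2 + xIm q ^ 2

/-- Real part of `x₂ w₁ + ε₁ z₁ Im x₁`. -/
def pCoord (ε₁ : ℝ) (q : V9) : ℝ :=
  (xRe q * mom q 0 + xIm q * mom q 1) / 2 + ε₁ * al q 2 * xIm q

/-- Imaginary part of `x₂ w₁ + ε₁ z₁ Im x₁`. -/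
def qCoord (ε₁ : ℝ) (q : V9) : ℝ :=
  (xRe q * mom q 1 - xIm q * mom q 0) / 2 + ε₁ * be q 2 * xIm q

/-- The equation `F = 0` with denominators cleared. -/
def EqF (a b ε₁ : ℝ) (q : V9) : Prop :=
  xNormSq q * mom q 2 = al q 2 * (xRe q * mom q 0 + xIm q * mom q 1)
    - be q 2 * (xRe q * mom q 1 - xIm q * mom q 0) + 2 * ε₁ * (a ^ 2 - b ^ 2) * xIm q

/-- The equation `F₁ = 0` with denominators cleared and reduced by means of `F = 0`. -/
def EqF₁ (ε₀ ε₁ : ℝ) (q : V9) : Prop :=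
  2 * pCoord ε₁ q * qCoord ε₁ q
    = xIm q * (ε₀ * xNormSq q + 2 * ε₁ ^ 2 * xIm q * al q 2 * be q 2)

/-- The part `x₁ x₂ ≠ 0` of the critical set. -/
def regularPart (a b ε₀ ε₁ : ℝ) : Set V9 :=
  {q | q ∈ P6 a b ∧ xNormSq q ≠ 0 ∧ EqF a b ε₁ q ∧ EqF₁ ε₀ ε₁ q}

/-! ### Real polynomial form of the equations -/

theorem mem_P6_iff (a b : ℝ) (q : V9) : q ∈ P6 a b ↔
    xRe q * yRe q - xIm q * yIm q + al q 2 ^ 2 - be q 2 ^ 2 = a ^ 2 - b ^ 2 ∧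
    xRe q * yIm q + xIm q * yRe q + 2 * al q 2 * be q 2 = 0 ∧
    xNormSq q + yRe q ^ 2 + yIm q ^ 2 + 2 * al q 2 ^ 2 + 2 * be q 2 ^ 2
      = 2 * (a ^ 2 + b ^ 2) := by
  simp only [P6, Set.mem_ofPred_eq, dotProduct, Fin.sum_univ_three, xNormSq, xRe, xIm, yRe, yIm]
  constructor
  · rintro ⟨h1, h2, h3⟩
    refine ⟨by linear_combination h1 - h2, by linear_combination 2 * h3,
      by linear_combination 2 * h1 + 2 * h2⟩
  · rintro ⟨h1, h2, h3⟩
    refine ⟨by linear_combination h1 / 2 + h3 / 4, by linear_combination h3 / 4 - h1 / 2,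
      by linear_combination h2 / 2⟩

theorem x₁_eq (q : V9) : x₁ q = xRe q + xIm q * Complex.I := by
  simp only [x₁, xRe, xIm]; push_cast; ring

theorem x₂_eq (q : V9) : x₂ q = xRe q - xIm q * Complex.I := by
  simp only [x₂, xRe, xIm]; push_cast; ring

theorem x₁_mul_x₂ (q : V9) : x₁ q * x₂ q = (xNormSq q : ℝ) := by
  rw [x₁_eq, x₂_eq, xNormSq]; push_cast
  linear_combination (-(xIm q : ℂ) ^ 2) * Complex.I_sq

theorem F_eq_zero_iff {a b ε₁ : ℝ} {q : V9} (hx : xNormSq q ≠ 0) :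
    F a b ε₁ q = 0 ↔ EqF a b ε₁ q := by
  have hpos : 0 < xNormSq q := lt_of_le_of_ne (by unfold xNormSq; positivity) hx.symm
  have hs : sqrtX q ^ 2 = (xNormSq q : ℝ) := by
    rw [sqrtX, x₁_mul_x₂, Complex.ofReal_re, ← Complex.ofReal_pow, Real.sq_sqrt hpos.le]
  have hs0 : sqrtX q ≠ 0 := by
    intro h
    rw [h] at hs
    apply hx
    exact_mod_cast (by simpa using hs.symm : (xNormSq q : ℂ) = 0)
  have key : sqrtX q * F a b ε₁ q =
      ((xNormSq q * mom q 2 - (al q 2 * (xRe q * mom q 0 + xIm q * mom q 1)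
        - be q 2 * (xRe q * mom q 1 - xIm q * mom q 0) + 2 * ε₁ * (a ^ 2 - b ^ 2) * xIm q) : ℝ) :
        ℂ) := by
    have h1 : sqrtX q * F a b ε₁ q = sqrtX q ^ 2 * w₃ q
        - (x₂ q * z₁ q * w₁ q + x₁ q * z₂ q * w₂ q)
        + Complex.I * ε₁ * rSq a b * (x₁ q - x₂ q) := by
      rw [F]; field_simp
    rw [h1, hs, x₁_eq, x₂_eq, z₁, z₂, w₁, w₂, w₃, rSq]
    push_cast
    ring_nf
    simp only [Complex.I_sq]
    ring
  constructor
  · intro h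
    rw [h, mul_zero] at key
    have := Complex.ofReal_eq_zero.1 key.symm
    unfold EqF
    linarith
  · intro h
    unfold EqF at h
    rw [h, sub_self, Complex.ofReal_zero] at key
    exact (mul_eq_zero.1 key).resolve_left hs0

/-- x₁x₂F₁ = x₂²ξ₁ - x₁²ξ₂ is a difference of conjugates, hence 2i times a real number. Eliminating
w₃ by F = 0 and completing the square gives the product of `pCoord` and `qCoord`. -/
theorem F₁_eq_zero_iff {a b ε₀ ε₁ : ℝ} {q : V9} (hx : xNormSq q ≠ 0) (hF : EqF a b ε₁ q) :
    F₁ a b ε₀ ε₁ q = 0 ↔ EqF₁ ε₀ ε₁ q := by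
  have hx0 : x₁ q * x₂ q ≠ 0 := by
    rw [x₁_mul_x₂]; exact_mod_cast hx
  have h1 : x₁ q ≠ 0 := left_ne_zero_of_mul hx0
  have h2 : x₂ q ≠ 0 := right_ne_zero_of_mul hx0
  have hF' : (xNormSq q * mom q 2 : ℂ) = al q 2 * (xRe q * mom q 0 + xIm q * mom q 1)
    - be q 2 * (xRe q * mom q 1 - xIm q * mom q 0) + 2 * ε₁ * (a ^ 2 - b ^ 2) * xIm q := by
    exact_mod_cast hF
  have key : x₁ q * x₂ q * F₁ a b ε₀ ε₁ q = 2 * Complex.I *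
      ((2 * pCoord ε₁ q * qCoord ε₁ q
        - xIm q * (ε₀ * xNormSq q + 2 * ε₁ ^ 2 * xIm q * al q 2 * be q 2) : ℝ) : ℂ) := by
    have h3 : x₁ q * x₂ q * F₁ a b ε₀ ε₁ q =
        x₂ q ^ 2 * ξ₁ a b ε₀ ε₁ q - x₁ q ^ 2 * ξ₂ a b ε₀ ε₁ q := by
      rw [F₁]; field_simp
    rw [h3, ξ₁, ξ₂, x₁_eq, x₂_eq, z₁, z₂, w₁, w₂, w₃, rSq]
    simp only [xNormSq, pCoord, qCoord] at hF' ⊢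
    push_cast at hF' ⊢
    have hI3 : Complex.I ^ 3 = -Complex.I := by rw [pow_succ, Complex.I_sq]; ring
    have hI5 : Complex.I ^ 5 = Complex.I := by rw [pow_succ, Complex.I_pow_four]; ring
    -- The multiplier is the coefficient of |x₁|²w₃ in x₂²ξ₁ - x₁²ξ₂.
    linear_combination (norm := (ring_nf; simp only [hI3, hI5]; ring))
      (-2 * Complex.I * ε₁ * xRe q) * hF'
  constructor
  · intro h
    rw [h, mul_zero] at key
    have h4 : (2 * Complex.I) ≠ 0 := by simp
    have := Complex.ofReal_eq_zero.1 ((mul_eq_zero.1 key.symm).resolve_left h4)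
    unfold EqF₁
    linarith
  · intro h
    unfold EqF₁ at h
    rw [h, sub_self, Complex.ofReal_zero, mul_zero] at key
    exact (mul_eq_zero.1 key).resolve_left hx0

theorem M2_eq_closure_regularPart (a b ε₀ ε₁ : ℝ) :
    M2 a b ε₀ ε₁ = closure (regularPart a b ε₀ ε₁) := by
  unfold M2 regularPart
  congr 1
  ext q
  simp only [Set.mem_ofPred_eq, x₁_mul_x₂, ne_eq, Complex.ofReal_eq_zero]
  refine and_congr_right fun _ => and_congr_right fun hx => ?_
  rw [F_eq_zero_iff hx]
  exact and_congr_right fun hF => F₁_eq_zero_iff hx hF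

/-! ### Tools for computing differentials -/

theorem surjective_fderiv_of_triangular {X : Type*} [NormedAddCommGroup X] [NormedSpace ℝ X]
    {n : ℕ} {f : Fin n → X → ℝ} {p : X} (hf : ∀ i, DifferentiableAt ℝ (f i) p)
    (v : Fin n → X) (hd : ∀ i, fderiv ℝ (f i) p (v i) ≠ 0)
    (h0 : ∀ i j, i < j → fderiv ℝ (f i) p (v j) = 0) :
    Function.Surjective (fderiv ℝ (fun t i => f i t) p) := by
  set M : Matrix (Fin n) (Fin n) ℝ := fun i j => fderiv ℝ (f i) p (v j) with hM
  have hdet : IsUnit M.det := by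
    rw [Matrix.det_of_isLowerTriangular M fun i j hij => h0 i j hij]
    exact (Finset.prod_ne_zero_iff.2 fun i _ => hd i).isUnit
  intro y
  refine ⟨∑ j, (M⁻¹.mulVec y) j • v j, ?_⟩
  have h1 : M.mulVec (M⁻¹.mulVec y) = y := by
    rw [Matrix.mulVec_mulVec, Matrix.mul_nonsing_inv _ hdet, Matrix.one_mulVec]
  rw [fderiv_pi hf]
  ext i
  rw [← congrFun h1 i]
  simp only [map_sum, map_smul, Finset.sum_apply, Pi.smul_apply, ContinuousLinearMap.coe_pi',
    smul_eq_mul, Matrix.mulVec, dotProduct, hM]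
  exact Finset.sum_congr rfl fun j _ => mul_comm _ _

theorem fderiv_eq_of_hasLineDerivAt {X Y : Type*} [NormedAddCommGroup X] [NormedSpace ℝ X]
    [NormedAddCommGroup Y] [NormedSpace ℝ Y]
    {f : X → Y} {p v : X} {c : Y} (hf : DifferentiableAt ℝ f p) (h : HasLineDerivAt ℝ f c p v) :
    fderiv ℝ f p v = c := by
  rw [← hf.lineDeriv_eq_fderiv]
  exact h.lineDeriv

theorem hasLineDerivAt_apply {n : ℕ} (p v : Fin n → ℝ) (i : Fin n) :
    HasLineDerivAt ℝ (fun t : Fin n → ℝ => t i) (v i) p v := by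
  have := (hasDerivAt_id (0 : ℝ)).mul_const (v i) |>.const_add (p i)
  simpa [HasLineDerivAt] using this

/-! Coordinates on the part `x₁ ≠ 0`: the real and imaginary parts of `x₁`, `z₁` and of
`x₂ w₁ + ε₁ z₁ Im x₁`. -/

def regularCoord (ε₁ : ℝ) (q : V9) : Fin 6 → ℝ :=
  ![xRe q, xIm q, al q 2, be q 2, pCoord ε₁ q, qCoord ε₁ q]

def tNormSq (t : Fin 6 → ℝ) : ℝ := t 0 ^ 2 + t 1 ^ 2

/-- Real part of y = x₂(r² - z₁²)/|x₁|², the solution of x₁y + z₁² = r². -/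
def tYRe (a b : ℝ) (t : Fin 6 → ℝ) : ℝ :=
  (t 0 * (a ^ 2 - b ^ 2 - t 2 ^ 2 + t 3 ^ 2) - 2 * t 1 * t 2 * t 3) / tNormSq t

def tYIm (a b : ℝ) (t : Fin 6 → ℝ) : ℝ :=
  (-2 * t 0 * t 2 * t 3 - t 1 * (a ^ 2 - b ^ 2 - t 2 ^ 2 + t 3 ^ 2)) / tNormSq t

def regularPoint (a b ε₁ : ℝ) (t : Fin 6 → ℝ) : V9 :=
  (![2 * (t 0 * (t 4 - ε₁ * t 2 * t 1) - t 1 * (t 5 - ε₁ * t 3 * t 1)) / tNormSq t,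
     2 * (t 0 * (t 5 - ε₁ * t 3 * t 1) + t 1 * (t 4 - ε₁ * t 2 * t 1)) / tNormSq t,
     2 * (t 2 * t 4 - t 3 * t 5 + ε₁ * t 1 * (a ^ 2 - b ^ 2 - t 2 ^ 2 + t 3 ^ 2)) / tNormSq t],
   ![(tYRe a b t + t 0) / 2, (t 1 - tYIm a b t) / 2, t 2],
   ![(t 1 + tYIm a b t) / 2, (tYRe a b t - t 0) / 2, t 3])

/-- The first function is the norm equation of the phase space after substituting for y and
multiplying by |x₁|². -/
def regularEqs (a b ε₀ ε₁ : ℝ) : Fin 2 → (Fin 6 → ℝ) → ℝ :=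
  ![fun t => tNormSq t ^ 2 + (a ^ 2 - b ^ 2 - t 2 ^ 2 + t 3 ^ 2) ^ 2 + 4 * t 2 ^ 2 * t 3 ^ 2
      + 2 * (t 2 ^ 2 + t 3 ^ 2) * tNormSq t - 2 * (a ^ 2 + b ^ 2) * tNormSq t,
    fun t => 2 * t 4 * t 5 - t 1 * (ε₀ * tNormSq t + 2 * ε₁ ^ 2 * t 1 * t 2 * t 3)]

/-! ### Parametrization of the part x₁ ≠ 0 -/

section regularPoint

variable {a b ε₀ ε₁ : ℝ} {t : Fin 6 → ℝ}

theorem xRe_regularPoint : xRe (regularPoint a b ε₁ t) = t 0 := by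
  simp [xRe, al, be, regularPoint]; ring

theorem xIm_regularPoint : xIm (regularPoint a b ε₁ t) = t 1 := by
  simp [xIm, al, be, regularPoint]; ring

theorem yRe_regularPoint : yRe (regularPoint a b ε₁ t) = tYRe a b t := by
  simp [yRe, al, be, regularPoint]; ring

theorem yIm_regularPoint : yIm (regularPoint a b ε₁ t) = tYIm a b t := by
  simp [yIm, al, be, regularPoint]; ring

theorem xNormSq_regularPoint : xNormSq (regularPoint a b ε₁ t) = tNormSq t := by
  rw [xNormSq, xRe_regularPoint, xIm_regularPoint, tNormSq]

theorem regularCoord_regularPoint (ht : tNormSq t ≠ 0) :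
    regularCoord ε₁ (regularPoint a b ε₁ t) = t := by
  have h4 : pCoord ε₁ (regularPoint a b ε₁ t) = t 4 := by
    rw [pCoord, xRe_regularPoint, xIm_regularPoint]
    simp only [mom, al, regularPoint, Matrix.cons_val]
    field_simp
    rw [tNormSq]; ring
  have h5 : qCoord ε₁ (regularPoint a b ε₁ t) = t 5 := by
    rw [qCoord, xRe_regularPoint, xIm_regularPoint]
    simp only [mom, be, regularPoint, Matrix.cons_val]
    field_simp
    rw [tNormSq]; ring
  ext i
  fin_cases i
  · exact xRe_regularPoint
  · exact xIm_regularPoint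
  · rfl
  · rfl
  · exact h4
  · exact h5

theorem eqF_regularPoint (ht : tNormSq t ≠ 0) : EqF a b ε₁ (regularPoint a b ε₁ t) := by
  rw [EqF, xNormSq_regularPoint, xRe_regularPoint, xIm_regularPoint]
  simp only [mom, al, be, regularPoint, Matrix.cons_val]
  field_simp
  rw [tNormSq]; ring

theorem regularPoint_mem (ht : tNormSq t ≠ 0) (h : ∀ i, regularEqs a b ε₀ ε₁ i t = 0) :
    regularPoint a b ε₁ t ∈ regularPart a b ε₀ ε₁ := by
  have hH := h 0
  have hK := h 1
  simp only [regularEqs, Matrix.cons_val] at hH hK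
  have h4 := congrFun (regularCoord_regularPoint (a := a) (b := b) (ε₁ := ε₁) ht) 4
  have h5 := congrFun (regularCoord_regularPoint (a := a) (b := b) (ε₁ := ε₁) ht) 5
  refine ⟨(mem_P6_iff a b _).2 ⟨?_, ?_, ?_⟩, ?_, eqF_regularPoint ht, ?_⟩
  · rw [xRe_regularPoint, xIm_regularPoint, yRe_regularPoint, yIm_regularPoint, tYRe, tYIm]
    simp only [al, be, regularPoint, Matrix.cons_val]
    field_simp
    rw [tNormSq]; ring
  · rw [xRe_regularPoint, xIm_regularPoint, yRe_regularPoint, yIm_regularPoint, tYRe, tYIm]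
    simp only [al, be, regularPoint, Matrix.cons_val]
    field_simp
    rw [tNormSq]; ring
  · rw [xNormSq_regularPoint, yRe_regularPoint, yIm_regularPoint, tYRe, tYIm]
    simp only [al, be, regularPoint, Matrix.cons_val]
    field_simp
    have hN : tNormSq t = t 0 ^ 2 + t 1 ^ 2 := rfl
    generalize tNormSq t = N at *
    subst hN
    linear_combination (t 0 ^ 2 + t 1 ^ 2) * hH
  · rwa [xNormSq_regularPoint]
  · change pCoord ε₁ _ = t 4 at h4
    change qCoord ε₁ _ = t 5 at h5
    rw [EqF₁, h4, h5, xNormSq_regularPoint, xIm_regularPoint]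
    simp only [al, be, regularPoint, Matrix.cons_val]
    linear_combination hK

theorem tNormSq_regularCoord (q : V9) : tNormSq (regularCoord ε₁ q) = xNormSq q := rfl

theorem regularEqs_regularCoord {q : V9} (hq : q ∈ regularPart a b ε₀ ε₁) (i : Fin 2) :
    regularEqs a b ε₀ ε₁ i (regularCoord ε₁ q) = 0 := by
  obtain ⟨hP, hx, hF, hF₁⟩ := hq
  obtain ⟨h1, h2, h3⟩ := (mem_P6_iff a b q).1 hP
  revert i
  refine Fin.forall_fin_two.2 ⟨?_, ?_⟩
  · simp only [regularEqs, Matrix.cons_val, tNormSq_regularCoord]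
    simp only [regularCoord, Matrix.cons_val]
    unfold xNormSq at *
    linear_combination (xRe q ^ 2 + xIm q ^ 2) * h3
      - (a ^ 2 - b ^ 2 - al q 2 ^ 2 + be q 2 ^ 2 + xRe q * yRe q - xIm q * yIm q) * h1
      + (2 * al q 2 * be q 2 - xRe q * yIm q - xIm q * yRe q) * h2
  · simp only [regularEqs, Matrix.cons_val, tNormSq_regularCoord]
    simp only [regularCoord, Matrix.cons_val]
    unfold EqF₁ at hF₁
    linear_combination hF₁

theorem regularPoint_regularCoord {q : V9} (hP : q ∈ P6 a b) (hx : xNormSq q ≠ 0)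
    (hF : EqF a b ε₁ q) : regularPoint a b ε₁ (regularCoord ε₁ q) = q := by
  obtain ⟨h1, h2, h3⟩ := (mem_P6_iff a b q).1 hP
  have hg : tYRe a b (regularCoord ε₁ q) = yRe q := by
    rw [tYRe, tNormSq_regularCoord, div_eq_iff hx]
    simp only [regularCoord, Matrix.cons_val, xNormSq]
    linear_combination -(xRe q) * h1 - xIm q * h2
  have hh : tYIm a b (regularCoord ε₁ q) = yIm q := by
    rw [tYIm, tNormSq_regularCoord, div_eq_iff hx]
    simp only [regularCoord, Matrix.cons_val, xNormSq]
    linear_combination (xIm q) * h1 - xRe q * h2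
  refine Prod.ext ?_ (Prod.ext ?_ ?_)
  · ext i
    fin_cases i
    · change _ / _ = mom q 0
      rw [tNormSq_regularCoord, div_eq_iff hx]
      simp only [regularCoord, Matrix.cons_val, xNormSq, pCoord, qCoord]
      ring
    · change _ / _ = mom q 1
      rw [tNormSq_regularCoord, div_eq_iff hx]
      simp only [regularCoord, Matrix.cons_val, xNormSq, pCoord, qCoord]
      ring
    · change _ / _ = mom q 2
      rw [tNormSq_regularCoord, div_eq_iff hx]
      simp only [regularCoord, Matrix.cons_val, pCoord, qCoord]
      unfold EqF at hF
      linear_combination -hF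
  · ext i
    fin_cases i
    · change (tYRe a b _ + xRe q) / 2 = al q 0
      rw [hg, yRe, xRe]; ring
    · change (xIm q - tYIm a b _) / 2 = al q 1
      rw [hh, yIm, xIm]; ring
    · rfl
  · ext i
    fin_cases i
    · change (xIm q + tYIm a b _) / 2 = be q 0
      rw [hh, yIm, xIm]; ring
    · change (tYRe a b _ - xRe q) / 2 = be q 1
      rw [hg, yRe, xRe]; ring
    · rfl

end regularPoint

/-! ### Charts at points with x₁ ≠ 0 -/

section regularChart

variable {a b ε₀ ε₁ : ℝ} {t : Fin 6 → ℝ}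

theorem contDiff_tNormSq : ContDiff ℝ ∞ tNormSq := by
  unfold tNormSq; fun_prop

theorem contDiff_regularEqs (i : Fin 2) : ContDiff ℝ ∞ (regularEqs a b ε₀ ε₁ i) := by
  have := contDiff_tNormSq
  revert i
  refine Fin.forall_fin_two.2 ⟨?_, ?_⟩ <;> simp only [regularEqs, Matrix.cons_val] <;> fun_prop

theorem contDiffOn_regularPoint :
    ContDiffOn ℝ ∞ (regularPoint a b ε₁) {t | tNormSq t ≠ 0} := by
  intro t ht
  have ht' : tNormSq t ≠ 0 := ht
  have := contDiff_tNormSq.contDiffAt (x := t)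
  refine ContDiffAt.contDiffWithinAt ?_
  have h1 : ContDiffAt ℝ ∞ (tYRe a b) t := by
    unfold tYRe; fun_prop (disch := assumption)
  have h2 : ContDiffAt ℝ ∞ (tYIm a b) t := by
    unfold tYIm; fun_prop (disch := assumption)
  unfold regularPoint
  refine ContDiffAt.prodMk ?_ (ContDiffAt.prodMk ?_ ?_) <;> rw [contDiffAt_pi] <;>
    simp only [Fin.forall_fin_succ, IsEmpty.forall_iff, and_true,
      Matrix.cons_val_zero, Matrix.cons_val_succ] <;>
    refine ⟨?_, ?_, ?_⟩ <;> fun_prop (disch := assumption)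

theorem contDiff_regularCoord : ContDiff ℝ ∞ (regularCoord ε₁) := by
  unfold regularCoord pCoord qCoord xRe xIm mom al be
  rw [contDiff_pi]
  simp only [Fin.forall_fin_succ, IsEmpty.forall_iff, and_true,
      Matrix.cons_val_zero, Matrix.cons_val_succ]
  refine ⟨?_, ?_, ?_, ?_, ?_, ?_⟩ <;> fun_prop

theorem hasLineDerivAt_tNormSq (t v : Fin 6 → ℝ) :
    HasLineDerivAt ℝ tNormSq (2 * t 0 * v 0 + 2 * t 1 * v 1) t v := by
  have h := fun i => hasLineDerivAt_apply t v i
  unfold HasLineDerivAt at h ⊢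
  refine ((h 0).fun_pow 2 |>.fun_add ((h 1).fun_pow 2)).congr_deriv ?_
  simp

theorem fderiv_regularEqs_zero (t v : Fin 6 → ℝ) :
    fderiv ℝ (regularEqs a b ε₀ ε₁ 0) t v =
      4 * (tNormSq t + t 2 ^ 2 + t 3 ^ 2 - (a ^ 2 + b ^ 2)) * (t 0 * v 0 + t 1 * v 1)
      + 4 * t 2 * (t 2 ^ 2 + t 3 ^ 2 + tNormSq t - (a ^ 2 - b ^ 2)) * v 2
      + 4 * t 3 * (t 2 ^ 2 + t 3 ^ 2 + tNormSq t + (a ^ 2 - b ^ 2)) * v 3 := by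
  refine fderiv_eq_of_hasLineDerivAt
    ((contDiff_regularEqs 0).differentiable (by simp)).differentiableAt ?_
  have h := fun i => hasLineDerivAt_apply t v i
  have hN := hasLineDerivAt_tNormSq t v
  unfold HasLineDerivAt at h hN ⊢
  simp only [regularEqs, Matrix.cons_val]
  have h1 := (((h 2).fun_pow 2).const_sub (a ^ 2 - b ^ 2)).fun_add ((h 3).fun_pow 2)
  have h2 := (((h 2).fun_pow 2).const_mul 4).fun_mul ((h 3).fun_pow 2)
  have h3 := ((((h 2).fun_pow 2).fun_add ((h 3).fun_pow 2)).const_mul 2).fun_mul hN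
  refine (((((hN.fun_pow 2).fun_add (h1.fun_pow 2)).fun_add h2).fun_add h3).fun_sub
    (hN.const_mul (2 * (a ^ 2 + b ^ 2)))).congr_deriv ?_
  simp
  ring

theorem fderiv_regularEqs_one (t v : Fin 6 → ℝ) :
    fderiv ℝ (regularEqs a b ε₀ ε₁ 1) t v =
      2 * (v 4 * t 5 + t 4 * v 5)
      - v 1 * (ε₀ * tNormSq t + 2 * ε₁ ^ 2 * t 1 * t 2 * t 3)
      - t 1 * (2 * ε₀ * (t 0 * v 0 + t 1 * v 1)
        + 2 * ε₁ ^ 2 * (v 1 * t 2 * t 3 + t 1 * v 2 * t 3 + t 1 * t 2 * v 3)) := by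
  refine fderiv_eq_of_hasLineDerivAt
    ((contDiff_regularEqs 1).differentiable (by simp)).differentiableAt ?_
  have h := fun i => hasLineDerivAt_apply t v i
  have hN := hasLineDerivAt_tNormSq t v
  unfold HasLineDerivAt at h hN ⊢
  simp only [regularEqs, Matrix.cons_val]
  have h1 := (((h 1).const_mul (2 * ε₁ ^ 2)).fun_mul (h 2)).fun_mul (h 3)
  refine ((((h 4).const_mul 2).fun_mul (h 5)).fun_sub
    ((h 1).fun_mul ((hN.const_mul ε₀).fun_add h1))).congr_deriv ?_
  simp
  ring

theorem tNormSq_nonneg : 0 ≤ tNormSq t := by unfold tNormSq; positivity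

/-- The first equation bounds a sum of nonnegative terms, among them (2 Re z₁ Im z₁)², by 2(a² +
b²)|x₁|² ≤ 4a²|x₁|². With |Im x₁| ≤ |x₁|, the ε₁² term is at most 2aε₁²|x₁|² in modulus. -/
theorem regularEqs_factor_pos (hb : 0 < b) (hab : b < a) (hε : ε₁ ^ 2 * (2 * a) < ε₀)
    (ht : tNormSq t ≠ 0) (h : regularEqs a b ε₀ ε₁ 0 t = 0) :
    0 < ε₀ * tNormSq t + 2 * ε₁ ^ 2 * t 1 * t 2 * t 3 := by
  have ha : 0 < a := hb.trans hab
  have hN : 0 < tNormSq t := lt_of_le_of_ne tNormSq_nonneg ht.symm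
  simp only [regularEqs, Matrix.cons_val] at h
  have h1 : t 1 ^ 2 ≤ tNormSq t := by unfold tNormSq; nlinarith [sq_nonneg (t 0)]
  have h2 : (2 * t 2 * t 3) ^ 2 ≤ 4 * a ^ 2 * tNormSq t := by
    have : b ^ 2 * tNormSq t ≤ a ^ 2 * tNormSq t := by gcongr
    have : 0 ≤ 2 * (t 2 ^ 2 + t 3 ^ 2) * tNormSq t := by positivity
    nlinarith [sq_nonneg (tNormSq t), sq_nonneg (a ^ 2 - b ^ 2 - t 2 ^ 2 + t 3 ^ 2)]
  have h3 : (t 1 * (2 * t 2 * t 3)) ^ 2 ≤ (2 * a * tNormSq t) ^ 2 := by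
    calc (t 1 * (2 * t 2 * t 3)) ^ 2 = t 1 ^ 2 * (2 * t 2 * t 3) ^ 2 := by ring
      _ ≤ tNormSq t * (4 * a ^ 2 * tNormSq t) := by gcongr
      _ = _ := by ring
  have h4 := abs_le_of_sq_le_sq' h3 (by positivity)
  have h5 : ε₁ ^ 2 * (-(2 * a * tNormSq t)) ≤ ε₁ ^ 2 * (t 1 * (2 * t 2 * t 3)) := by
    gcongr; exact h4.1
  nlinarith

theorem surjective_fderiv_regularEqs (hb : 0 < b) (hab : b < a) (hε₀ : 0 < ε₀)
    (hε : ε₁ ^ 2 * (2 * a) < ε₀) (ht : tNormSq t ≠ 0) (h : ∀ i, regularEqs a b ε₀ ε₁ i t = 0) :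
    Function.Surjective (fderiv ℝ (fun s i => regularEqs a b ε₀ ε₁ i s) t) := by
  have hN : 0 < tNormSq t := lt_of_le_of_ne tNormSq_nonneg ht.symm
  have hH := h 0
  have hK := h 1
  have hpos := regularEqs_factor_pos hb hab hε ht hH
  simp only [regularEqs, Matrix.cons_val] at hH hK
  have hr : 0 < a ^ 2 - b ^ 2 := by nlinarith
  -- A critical zero would have z₁ = 0 and |x₁|² = a² + b², but there the function equals -4a²b².
  have hv : ∃ v, fderiv ℝ (regularEqs a b ε₀ ε₁ 0) t v ≠ 0 := by
    by_contra! hcon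
    have e0 := hcon ![t 0, t 1, 0, 0, 0, 0]
    have e2 := hcon ![0, 0, 1, 0, 0, 0]
    have e3 := hcon ![0, 0, 0, 1, 0, 0]
    rw [fderiv_regularEqs_zero] at e0 e2 e3
    simp only [Matrix.cons_val, mul_zero, mul_one, add_zero, zero_add] at e0 e2 e3
    have t3 : t 3 = 0 := by
      have : t 2 ^ 2 + t 3 ^ 2 + tNormSq t + (a ^ 2 - b ^ 2) ≠ 0 := by positivity
      simpa [this] using e3
    have e0' : tNormSq t + t 2 ^ 2 + t 3 ^ 2 - (a ^ 2 + b ^ 2) = 0 := by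
      have : t 0 * t 0 + t 1 * t 1 ≠ 0 := by
        intro h; apply ht; rw [tNormSq]; linarith
      simpa [this] using e0
    have t2 : t 2 = 0 := by
      have : t 2 ^ 2 + t 3 ^ 2 + tNormSq t - (a ^ 2 - b ^ 2) ≠ 0 := by
        intro h; nlinarith
      simpa [this] using e2
    rw [t2, t3] at hH e0'
    have hN' : tNormSq t = a ^ 2 + b ^ 2 := by linarith
    rw [hN'] at hH
    have : 0 < a ^ 2 * b ^ 2 := by have := hb.trans hab; positivity
    nlinarith
  -- The first function depends on x₁ only through |x₁| and not on the last two coordinates, so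
  -- those two directions and the rotation of x₁ are tested. If all fail, the second equation forces
  -- Im x₁ = 0, then the rotation forces Re x₁ = 0.
  have hw : ∃ v, fderiv ℝ (regularEqs a b ε₀ ε₁ 0) t v = 0 ∧
      fderiv ℝ (regularEqs a b ε₀ ε₁ 1) t v ≠ 0 := by
    by_contra! hcon
    have e4 := hcon ![0, 0, 0, 0, 1, 0]
    have e5 := hcon ![0, 0, 0, 0, 0, 1]
    have e1 := hcon ![-t 1, t 0, 0, 0, 0, 0]
    rw [fderiv_regularEqs_zero, fderiv_regularEqs_one] at e1 e4 e5
    simp only [Matrix.cons_val] at e1 e4 e5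
    replace e4 := e4 (by ring)
    replace e5 := e5 (by ring)
    replace e1 := e1 (by ring)
    have t4 : t 4 = 0 := by linarith
    have t1 : t 1 = 0 := by
      have h' : t 1 * (ε₀ * tNormSq t + 2 * ε₁ ^ 2 * t 1 * t 2 * t 3) = 0 := by
        rw [t4] at hK; linarith
      exact (mul_eq_zero.1 h').resolve_right hpos.ne'
    rw [t1] at e1
    have t0 : t 0 * (ε₀ * tNormSq t) = 0 := by linarith
    have t0' : t 0 = 0 := (mul_eq_zero.1 t0).resolve_right (by positivity)
    exact ht (by rw [tNormSq, t0', t1]; ring)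
  obtain ⟨v, hv⟩ := hv
  obtain ⟨w, hw0, hw1⟩ := hw
  refine surjective_fderiv_of_triangular
    (fun i => ((contDiff_regularEqs i).differentiable (by simp)).differentiableAt) ![v, w] ?_ ?_
  · exact Fin.forall_fin_two.2 ⟨hv, hw1⟩
  · intro i j hij
    have hi : i = 0 := by omega
    have hj : j = 1 := by omega
    subst hi hj
    exact hw0

theorem continuous_xRe : Continuous xRe := by unfold xRe al be; fun_prop

theorem continuous_xIm : Continuous xIm := by unfold xIm al be; fun_prop

theorem continuous_xNormSq : Continuous xNormSq := by
  have := continuous_xRe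
  have := continuous_xIm
  unfold xNormSq; fun_prop

theorem isClosed_P6 (a b : ℝ) : IsClosed (P6 a b) := by
  unfold P6 al be
  simp only [dotProduct, Fin.sum_univ_three]
  refine (isClosed_eq ?_ ?_).inter ((isClosed_eq ?_ ?_).inter (isClosed_eq ?_ ?_)) <;> fun_prop

/-- The cleared equations are closed conditions, so the closure adds only points with x₁ = 0. -/
theorem mem_regularPart_of_mem_M2 {q : V9} (hq : q ∈ M2 a b ε₀ ε₁) (hx : xNormSq q ≠ 0) :
    q ∈ regularPart a b ε₀ ε₁ := by
  rw [M2_eq_closure_regularPart] at hq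
  have h1 := continuous_xRe
  have h2 := continuous_xIm
  have h3 := continuous_xNormSq
  have hc : IsClosed {q | q ∈ P6 a b ∧ EqF a b ε₁ q ∧ EqF₁ ε₀ ε₁ q} := by
    refine (isClosed_P6 a b).inter ((isClosed_eq ?_ ?_).inter (isClosed_eq ?_ ?_)) <;>
      simp only [pCoord, qCoord, mom, al, be] <;> fun_prop
  have hsub : regularPart a b ε₀ ε₁ ⊆ {q | q ∈ P6 a b ∧ EqF a b ε₁ q ∧ EqF₁ ε₀ ε₁ q} :=
    fun q hq => ⟨hq.1, hq.2.2⟩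
  obtain ⟨hP, hF⟩ := closure_minimal hsub hc hq
  exact ⟨hP, hx, hF⟩

theorem exists_chart_regular (hb : 0 < b) (hab : b < a) (hε₀ : 0 < ε₀)
    (hε : ε₁ ^ 2 * (2 * a) < ε₀) {q : V9} (hq : q ∈ M2 a b ε₀ ε₁) (hx : xNormSq q ≠ 0) :
    ∃ (U : Set V9) (V : Set (Fin 4 → ℝ)) (φ : (Fin 4 → ℝ) → V9) (ψ : V9 → (Fin 4 → ℝ)),
      IsOpen U ∧ q ∈ U ∧ IsOpen V ∧ ContDiffOn ℝ ∞ φ V ∧ ContDiffOn ℝ ∞ ψ U ∧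
      φ '' V = M2 a b ε₀ ε₁ ∩ U ∧ ∀ v ∈ V, ψ (φ v) = v := by
  have hreg := mem_regularPart_of_mem_M2 hq hx
  have hinv := regularPoint_regularCoord hreg.1 hx hreg.2.2.1
  have hp : tNormSq (regularCoord ε₁ q) ≠ 0 := hx
  have hO : IsOpen {t : Fin 6 → ℝ | tNormSq t ≠ 0} :=
    isOpen_ne_fun contDiff_tNormSq.continuous continuous_const
  have hπ := contDiffOn_regularPoint (a := a) (b := b) (ε₁ := ε₁)
  have hreg0 := regularEqs_regularCoord hreg
  have key := exists_chart_of_levelSet (k := 4) (S := M2 a b ε₀ ε₁)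
    (G := fun s i => regularEqs a b ε₀ ε₁ i s) hO hp
    (contDiff_pi.2 fun i => contDiff_regularEqs i).contDiffOn hπ
    (surjective_fderiv_regularEqs hb hab hε₀ hε hp hreg0) ?_ (by simp) ?_ ?_
  · rwa [hinv] at key
  · intro v _ hv
    -- `regularCoord` is a smooth left inverse of `regularPoint`, which is therefore an immersion.
    have h1 : HasFDerivAt (fun t => regularCoord ε₁ (regularPoint a b ε₁ t))
        ((fderiv ℝ (regularCoord ε₁) (regularPoint a b ε₁ (regularCoord ε₁ q))).comp
          (fderiv ℝ (regularPoint a b ε₁) (regularCoord ε₁ q))) (regularCoord ε₁ q) :=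
      ((contDiff_regularCoord.differentiable (by simp)).differentiableAt.hasFDerivAt).comp _
        (((hπ.contDiffAt (hO.mem_nhds hp)).differentiableAt (by simp)).hasFDerivAt)
    have h2 : HasFDerivAt (fun t => regularCoord ε₁ (regularPoint a b ε₁ t))
        (ContinuousLinearMap.id ℝ _) (regularCoord ε₁ q) := by
      refine (hasFDerivAt_id _).congr_of_eventuallyEq ?_
      filter_upwards [hO.mem_nhds hp] with t ht using regularCoord_regularPoint ht
    have h3 := congrArg (fun A => A v) (h1.unique h2)
    simp only [ContinuousLinearMap.comp_apply, hv, map_zero, ContinuousLinearMap.id_apply] at h3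
    exact h3.symm
  · intro t ht h0
    rw [M2_eq_closure_regularPart]
    exact subset_closure (regularPoint_mem ht fun i => congrFun h0 i)
  · intro O' hO'
    rw [hinv]
    refine ⟨regularCoord ε₁ ⁻¹' O' ∩ {q | xNormSq q ≠ 0}, ?_, ?_⟩
    · exact Filter.inter_mem (contDiff_regularCoord.continuous.continuousAt.preimage_mem_nhds hO')
        ((isOpen_ne_fun continuous_xNormSq continuous_const).mem_nhds hx)
    · rintro q' ⟨hq', hq'O, hx'⟩
      have hreg' := mem_regularPart_of_mem_M2 hq' hx'
      exact ⟨regularCoord ε₁ q', ⟨hq'O, funext fun i => regularEqs_regularCoord hreg' i⟩,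
        regularPoint_regularCoord hreg'.1 hx' hreg'.2.2.1⟩

end regularChart

open Real

/-! Coordinates near `x₁ = 0`. The point `x₁` is blown up as `x₁ = λ e` with `e = exp (i θ)`, and
`w₁ + i ε₁ z₁ = e (U + i V)`. The coordinates are `(θ, λ, Re z₁, Im z₁, yRe, yIm, U, V, M₃)`. -/

def blowCoord (ε₁ θ : ℝ) (q : V9) : Fin 9 → ℝ :=
  ![θ, cos θ * xRe q + sin θ * xIm q, al q 2, be q 2, yRe q, yIm q,
    cos θ * (mom q 0 / 2 - ε₁ * be q 2) + sin θ * (mom q 1 / 2 + ε₁ * al q 2),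
    cos θ * (mom q 1 / 2 + ε₁ * al q 2) - sin θ * (mom q 0 / 2 - ε₁ * be q 2),
    mom q 2]

def blowPoint (ε₁ : ℝ) (t : Fin 9 → ℝ) : V9 :=
  (![2 * (cos (t 0) * t 6 - sin (t 0) * t 7 + ε₁ * t 3),
     2 * (sin (t 0) * t 6 + cos (t 0) * t 7 - ε₁ * t 2), t 8],
   ![(t 4 + t 1 * cos (t 0)) / 2, (t 1 * sin (t 0) - t 5) / 2, t 2],
   ![(t 1 * sin (t 0) + t 5) / 2, (t 4 - t 1 * cos (t 0)) / 2, t 3])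

/-- The imaginary part of `exp (-i θ) (ε₀ - i ε₁ M₃ - ε₁² y)`. -/
def etaIm (ε₀ ε₁ : ℝ) (t : Fin 9 → ℝ) : ℝ :=
  -(ε₀ * sin (t 0)) - ε₁ * cos (t 0) * t 8 - ε₁ ^ 2 * (cos (t 0) * t 5 - sin (t 0) * t 4)

/-- The parameter `λ` and the five functions whose common zeros form the blown up critical set. -/
def blowFns (a b ε₀ ε₁ : ℝ) : Fin 6 → (Fin 9 → ℝ) → ℝ :=
  ![fun t => t 1,
    fun t => t 1 * (cos (t 0) * t 4 - sin (t 0) * t 5) + t 2 ^ 2 - t 3 ^ 2 - (a ^ 2 - b ^ 2),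
    fun t => t 1 * (sin (t 0) * t 4 + cos (t 0) * t 5) + 2 * t 2 * t 3,
    fun t => t 1 ^ 2 + t 4 ^ 2 + t 5 ^ 2 + 2 * t 2 ^ 2 + 2 * t 3 ^ 2 - 2 * (a ^ 2 + b ^ 2),
    fun t => t 2 * t 6 - t 3 * t 7 - t 1 * (t 8 + 2 * ε₁ * t 5) / 2,
    fun t => t 7 * (t 8 + 2 * ε₁ * t 5) * t 2
      - t 7 ^ 2 * (sin (t 0) * t 4 + cos (t 0) * t 5) + t 2 ^ 2 * etaIm ε₀ ε₁ t]

def blowEqs (a b ε₀ ε₁ : ℝ) (t : Fin 9 → ℝ) (i : Fin 5) : ℝ := blowFns a b ε₀ ε₁ i.succ t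

/-! ### The blow-up of x₁ = 0 -/

section blow

variable {a b ε₀ ε₁ θ : ℝ} {t : Fin 9 → ℝ} {q : V9}

theorem xRe_blowPoint : xRe (blowPoint ε₁ t) = t 1 * cos (t 0) := by
  simp [xRe, al, be, blowPoint]; ring

theorem xIm_blowPoint : xIm (blowPoint ε₁ t) = t 1 * sin (t 0) := by
  simp [xIm, al, be, blowPoint]; ring

theorem yRe_blowPoint : yRe (blowPoint ε₁ t) = t 4 := by
  simp [yRe, al, be, blowPoint]; ring

theorem yIm_blowPoint : yIm (blowPoint ε₁ t) = t 5 := by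
  simp [yIm, al, be, blowPoint]; ring

theorem xNormSq_blowPoint : xNormSq (blowPoint ε₁ t) = t 1 ^ 2 := by
  rw [xNormSq, xRe_blowPoint, xIm_blowPoint]
  linear_combination t 1 ^ 2 * sin_sq_add_cos_sq (t 0)

/-- The hypothesis says that x₁ is a real multiple, of either sign, of exp(iθ). -/
theorem blowPoint_blowCoord (h : cos θ * xIm q = sin θ * xRe q) :
    blowPoint ε₁ (blowCoord ε₁ θ q) = q := by
  have hcs := sin_sq_add_cos_sq θ
  have hX : (cos θ * xRe q + sin θ * xIm q) * cos θ = xRe q := by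
    linear_combination sin θ * h + xRe q * hcs
  have hY : (cos θ * xRe q + sin θ * xIm q) * sin θ = xIm q := by
    linear_combination -cos θ * h + xIm q * hcs
  refine Prod.ext ?_ (Prod.ext ?_ ?_)
  · ext i
    fin_cases i
    · change _ = mom q 0
      simp [blowPoint, blowCoord]
      linear_combination (mom q 0 - 2 * ε₁ * be q 2) * hcs
    · change _ = mom q 1
      simp [blowPoint, blowCoord]
      linear_combination (mom q 1 + 2 * ε₁ * al q 2) * hcs
    · rfl
  · ext i
    fin_cases i
    · change (yRe q + (cos θ * xRe q + sin θ * xIm q) * cos θ) / 2 = al q 0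
      rw [hX, yRe, xRe]; ring
    · change ((cos θ * xRe q + sin θ * xIm q) * sin θ - yIm q) / 2 = al q 1
      rw [hY, yIm, xIm]; ring
    · rfl
  · ext i
    fin_cases i
    · change ((cos θ * xRe q + sin θ * xIm q) * sin θ + yIm q) / 2 = be q 0
      rw [hY, yIm, xIm]; ring
    · change (yRe q - (cos θ * xRe q + sin θ * xIm q) * cos θ) / 2 = be q 1
      rw [hX, yRe, xRe]; ring
    · rfl

/-- The hypotheses make `t 2 * t 3` and `t 2 ^ 2 * t 6` multiples of λ = `t 1`, so λ splits off `t 2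
^ 2` times the F₁ equation. The quotient still constrains the limit λ → 0. -/
theorem blowFns_reduction
    (h2 : t 1 * (sin (t 0) * t 4 + cos (t 0) * t 5) + 2 * t 2 * t 3 = 0)
    (h4 : t 2 * t 6 - t 3 * t 7 - t 1 * (t 8 + 2 * ε₁ * t 5) / 2 = 0) :
    t 1 * (t 7 * (t 8 + 2 * ε₁ * t 5) * t 2
      - t 7 ^ 2 * (sin (t 0) * t 4 + cos (t 0) * t 5) + t 2 ^ 2 * etaIm ε₀ ε₁ t) =
    t 2 ^ 2 * (2 * (t 6 + ε₁ * cos (t 0) * t 3) * (t 7 - ε₁ * cos (t 0) * t 2)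
      - sin (t 0) * (ε₀ * t 1 + 2 * ε₁ ^ 2 * sin (t 0) * t 2 * t 3)) := by
  unfold etaIm
  linear_combination (-2 * t 7 * t 2 + 2 * ε₁ * cos (t 0) * t 2 ^ 2) * h4
    + (-t 7 ^ 2 + ε₁ ^ 2 * t 2 ^ 2) * h2
    + 2 * ε₁ ^ 2 * t 2 ^ 3 * t 3 * sin_sq_add_cos_sq (t 0)

theorem blowEqs_eq_zero_iff : blowEqs a b ε₀ ε₁ t = 0 ↔
    t 1 * (cos (t 0) * t 4 - sin (t 0) * t 5) + t 2 ^ 2 - t 3 ^ 2 - (a ^ 2 - b ^ 2) = 0 ∧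
    t 1 * (sin (t 0) * t 4 + cos (t 0) * t 5) + 2 * t 2 * t 3 = 0 ∧
    t 1 ^ 2 + t 4 ^ 2 + t 5 ^ 2 + 2 * t 2 ^ 2 + 2 * t 3 ^ 2 - 2 * (a ^ 2 + b ^ 2) = 0 ∧
    t 2 * t 6 - t 3 * t 7 - t 1 * (t 8 + 2 * ε₁ * t 5) / 2 = 0 ∧
    t 7 * (t 8 + 2 * ε₁ * t 5) * t 2
      - t 7 ^ 2 * (sin (t 0) * t 4 + cos (t 0) * t 5) + t 2 ^ 2 * etaIm ε₀ ε₁ t = 0 := by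
  constructor
  · intro h
    exact ⟨congrFun h 0, congrFun h 1, congrFun h 2, congrFun h 3, congrFun h 4⟩
  · rintro ⟨h0, h1, h2, h3, h4⟩
    ext i
    fin_cases i
    exacts [h0, h1, h2, h3, h4]

theorem blowPoint_mem_regularPart (h : blowEqs a b ε₀ ε₁ t = 0) (h1 : t 1 ≠ 0) (h2 : t 2 ≠ 0) :
    blowPoint ε₁ t ∈ regularPart a b ε₀ ε₁ := by
  obtain ⟨e1, e2, e3, e4, e5⟩ := blowEqs_eq_zero_iff.1 h
  have hcs := sin_sq_add_cos_sq (t 0)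
  have hK := blowFns_reduction (ε₀ := ε₀) e2 e4
  rw [e5, mul_zero] at hK
  replace hK := (mul_eq_zero.1 hK.symm).resolve_left (pow_ne_zero 2 h2)
  have hp : pCoord ε₁ (blowPoint ε₁ t) = t 1 * (t 6 + ε₁ * cos (t 0) * t 3) := by
    rw [pCoord, xRe_blowPoint, xIm_blowPoint]
    simp only [mom, al, blowPoint, Matrix.cons_val]
    linear_combination t 1 * t 6 * hcs
  have hq : qCoord ε₁ (blowPoint ε₁ t) = t 1 * (t 7 - ε₁ * cos (t 0) * t 2) := by
    rw [qCoord, xRe_blowPoint, xIm_blowPoint]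
    simp only [mom, be, blowPoint, Matrix.cons_val]
    linear_combination t 1 * t 7 * hcs
  refine ⟨(mem_P6_iff a b _).2 ⟨?_, ?_, ?_⟩, ?_, ?_, ?_⟩
  · rw [xRe_blowPoint, xIm_blowPoint, yRe_blowPoint, yIm_blowPoint]
    simp only [al, be, blowPoint, Matrix.cons_val]
    linear_combination e1
  · rw [xRe_blowPoint, xIm_blowPoint, yRe_blowPoint, yIm_blowPoint]
    simp only [al, be, blowPoint, Matrix.cons_val]
    linear_combination e2
  · rw [xNormSq_blowPoint, yRe_blowPoint, yIm_blowPoint]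
    simp only [al, be, blowPoint, Matrix.cons_val]
    linear_combination e3
  · rw [xNormSq_blowPoint]; exact pow_ne_zero 2 h1
  · rw [EqF, xNormSq_blowPoint, xRe_blowPoint, xIm_blowPoint]
    simp only [mom, al, be, blowPoint, Matrix.cons_val]
    linear_combination t 1 * (-2 * e4 + 2 * ε₁ * sin (t 0) * e1 - 2 * ε₁ * cos (t 0) * e2
      + (2 * ε₁ * t 1 * t 5 - 2 * (t 2 * t 6 - t 3 * t 7)) * hcs)
  · rw [EqF₁, hp, hq, xNormSq_blowPoint, xIm_blowPoint]
    simp only [al, be, blowPoint, Matrix.cons_val]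
    linear_combination t 1 ^ 2 * hK

theorem blowEqs_blowCoord (hq : q ∈ regularPart a b ε₀ ε₁)
    (h : cos θ * xIm q = sin θ * xRe q) : blowEqs a b ε₀ ε₁ (blowCoord ε₁ θ q) = 0 := by
  obtain ⟨hP, hx, hF, hF₁⟩ := hq
  obtain ⟨h1, h2, h3⟩ := (mem_P6_iff a b q).1 hP
  have hcs := sin_sq_add_cos_sq θ
  set l := cos θ * xRe q + sin θ * xIm q with hl
  have hX : xRe q = l * cos θ := by
    linear_combination -sin θ * h - xRe q * hcs
  have hY : xIm q = l * sin θ := by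
    linear_combination cos θ * h - xIm q * hcs
  have hN : xNormSq q = l ^ 2 := by
    rw [xNormSq, hX, hY]; linear_combination l ^ 2 * hcs
  have hl0 : l ≠ 0 := by
    rintro h0; rw [hN, h0] at hx; exact hx (by ring)
  unfold EqF at hF
  unfold EqF₁ pCoord qCoord at hF₁
  rw [hN, hX, hY] at hF hF₁
  rw [hX, hY] at h1 h2
  rw [hN] at h3
  have hF' := mul_left_cancel₀ hl0 (a := l) (b := l * mom q 2)
    (c := al q 2 * (cos θ * mom q 0 + sin θ * mom q 1)
      - be q 2 * (cos θ * mom q 1 - sin θ * mom q 0) + 2 * ε₁ * (a ^ 2 - b ^ 2) * sin θ)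
    (by linear_combination hF)
  set t := blowCoord ε₁ θ q with ht
  have e1 : t 1 * (cos (t 0) * t 4 - sin (t 0) * t 5) + t 2 ^ 2 - t 3 ^ 2
      - (a ^ 2 - b ^ 2) = 0 := by
    simp only [ht, blowCoord, Matrix.cons_val, ← hl]
    linear_combination h1
  have e2 : t 1 * (sin (t 0) * t 4 + cos (t 0) * t 5) + 2 * t 2 * t 3 = 0 := by
    simp only [ht, blowCoord, Matrix.cons_val, ← hl]
    linear_combination h2
  have e4 : t 2 * t 6 - t 3 * t 7 - t 1 * (t 8 + 2 * ε₁ * t 5) / 2 = 0 := by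
    simp only [ht, blowCoord, Matrix.cons_val, ← hl]
    linear_combination -hF' / 2 + ε₁ * sin θ * h1 - ε₁ * cos θ * h2 + ε₁ * l * yIm q * hcs
  refine blowEqs_eq_zero_iff.2 ⟨e1, e2, ?_, e4, ?_⟩
  · simp only [ht, blowCoord, Matrix.cons_val, ← hl]
    linear_combination h3
  · have hK := blowFns_reduction (ε₀ := ε₀) e2 e4
    have hz : 2 * (t 6 + ε₁ * cos (t 0) * t 3) * (t 7 - ε₁ * cos (t 0) * t 2)
      - sin (t 0) * (ε₀ * t 1 + 2 * ε₁ ^ 2 * sin (t 0) * t 2 * t 3) = 0 := by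
      refine mul_left_cancel₀ (pow_ne_zero 2 hl0) ?_
      simp only [ht, blowCoord, Matrix.cons_val, ← hl]
      linear_combination hF₁
    rw [hz, mul_zero] at hK
    exact (mul_eq_zero.1 hK).resolve_left hl0

end blow

/-! ### Independence of the blown-up equations on λ = 0 -/

section blowDeriv

variable {a b ε₀ ε₁ θ : ℝ} {t : Fin 9 → ℝ} {q : V9}

theorem contDiff_blowFns (i : Fin 6) : ContDiff ℝ ∞ (blowFns a b ε₀ ε₁ i) := by
  revert i
  simp only [Fin.forall_fin_succ, IsEmpty.forall_iff, and_true]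
  simp only [blowFns, Matrix.cons_val_zero, Matrix.cons_val_succ, etaIm]
  refine ⟨?_, ?_, ?_, ?_, ?_, ?_⟩ <;> fun_prop

theorem contDiff_blowEqs : ContDiff ℝ ∞ (blowEqs a b ε₀ ε₁) :=
  contDiff_pi.2 fun i => contDiff_blowFns i.succ

theorem contDiff_blowPoint : ContDiff ℝ ∞ (blowPoint ε₁) := by
  unfold blowPoint
  refine ContDiff.prodMk ?_ (ContDiff.prodMk ?_ ?_) <;> rw [contDiff_pi] <;>
    simp only [Fin.forall_fin_succ, IsEmpty.forall_iff, and_true,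
      Matrix.cons_val_zero, Matrix.cons_val_succ] <;>
    refine ⟨?_, ?_, ?_⟩ <;> fun_prop

theorem hasDerivAt_line_apply (t v : Fin 9 → ℝ) (i : Fin 9) :
    HasDerivAt (fun s : ℝ => (t + s • v) i) (v i) 0 :=
  hasLineDerivAt_apply t v i

theorem fderiv_blowFns (h1 : t 1 = 0) (h3 : t 3 = 0) (v : Fin 9 → ℝ) (i : Fin 6) :
    fderiv ℝ (blowFns a b ε₀ ε₁ i) t v =
      ![v 1,
        v 1 * (cos (t 0) * t 4 - sin (t 0) * t 5) + 2 * t 2 * v 2,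
        v 1 * (sin (t 0) * t 4 + cos (t 0) * t 5) + 2 * t 2 * v 3,
        2 * t 4 * v 4 + 2 * t 5 * v 5 + 4 * t 2 * v 2,
        v 2 * t 6 + t 2 * v 6 - v 3 * t 7 - v 1 * (t 8 + 2 * ε₁ * t 5) / 2,
        v 7 * (t 8 + 2 * ε₁ * t 5) * t 2 + t 7 * (v 8 + 2 * ε₁ * v 5) * t 2
          + t 7 * (t 8 + 2 * ε₁ * t 5) * v 2
          - 2 * t 7 * v 7 * (sin (t 0) * t 4 + cos (t 0) * t 5)
          - t 7 ^ 2 * (v 0 * (cos (t 0) * t 4 - sin (t 0) * t 5)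
            + sin (t 0) * v 4 + cos (t 0) * v 5)
          + 2 * t 2 * v 2 * etaIm ε₀ ε₁ t
          + t 2 ^ 2 * (v 0 * (-(ε₀ * cos (t 0)) + ε₁ * sin (t 0) * t 8
              + ε₁ ^ 2 * (sin (t 0) * t 5 + cos (t 0) * t 4))
            - ε₁ * cos (t 0) * v 8 - ε₁ ^ 2 * (cos (t 0) * v 5 - sin (t 0) * v 4))] i := by
  refine fderiv_eq_of_hasLineDerivAt
    ((contDiff_blowFns i).differentiable (by simp)).differentiableAt ?_
  have h := hasDerivAt_line_apply t v
  have hc := (h 0).cos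
  have hs := (h 0).sin
  have hY1 := (hc.fun_mul (h 4)).fun_sub (hs.fun_mul (h 5))
  have hY2 := (hs.fun_mul (h 4)).fun_add (hc.fun_mul (h 5))
  have hw := (h 8).fun_add ((h 5).const_mul (2 * ε₁))
  unfold HasLineDerivAt
  revert i
  simp only [Fin.forall_fin_succ, IsEmpty.forall_iff, and_true]
  simp only [blowFns, Matrix.cons_val_zero, Matrix.cons_val_succ, etaIm]
  refine ⟨h 1, ?_, ?_, ?_, ?_, ?_⟩
  · refine (((((h 1).fun_mul hY1).fun_add ((h 2).fun_pow 2)).fun_sub ((h 3).fun_pow 2)).sub_const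
      (a ^ 2 - b ^ 2)).congr_deriv ?_
    simp [h1, h3]
  · refine (((h 1).fun_mul hY2).fun_add (((h 2).const_mul 2).fun_mul (h 3))).congr_deriv ?_
    simp [h1, h3]
  · refine ((((((h 1).fun_pow 2).fun_add ((h 4).fun_pow 2)).fun_add ((h 5).fun_pow 2)).fun_add
      (((h 2).fun_pow 2).const_mul 2)).fun_add (((h 3).fun_pow 2).const_mul 2)).sub_const
      (2 * (a ^ 2 + b ^ 2)) |>.congr_deriv ?_
    simp [h1, h3]; ring
  · refine ((((h 2).fun_mul (h 6)).fun_sub ((h 3).fun_mul (h 7))).fun_sub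
      (((h 1).fun_mul hw).div_const 2)).congr_deriv ?_
    simp [h1, h3]
  · have he := (((hs.const_mul ε₀).fun_neg).fun_sub ((hc.const_mul ε₁).fun_mul (h 8))).fun_sub
      (((hc.fun_mul (h 5)).fun_sub (hs.fun_mul (h 4))).const_mul (ε₁ ^ 2))
    refine (((((h 7).fun_mul hw).fun_mul (h 2)).fun_sub (((h 7).fun_pow 2).fun_mul hY2)).fun_add
      (((h 2).fun_pow 2).fun_mul he)).congr_deriv ?_
    simp
    ring

/-- The term `ε₁² k` is too small to compensate `ε₀` if `|k|` is bounded by the modulus of `y`. -/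
theorem eta_factor_pos (hb : 0 < b) (hab : b < a) (hε : ε₁ ^ 2 * (2 * a) < ε₀)
    {g h k : ℝ} (hgh : g ^ 2 + h ^ 2 ≤ 2 * (a ^ 2 + b ^ 2)) (hk : k ^ 2 ≤ g ^ 2 + h ^ 2) :
    0 < ε₀ - ε₁ ^ 2 * k := by
  have h1 : k ≤ 2 * a := by
    refine le_of_sq_le_sq ?_ (by linarith)
    nlinarith
  nlinarith [mul_le_mul_of_nonneg_left h1 (sq_nonneg ε₁)]

theorem sq_rotate_le {c s : ℝ} (hcs : s ^ 2 + c ^ 2 = 1) (g h : ℝ) :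
    (s * g + c * h) ^ 2 ≤ g ^ 2 + h ^ 2 := by
  have : (s * g + c * h) ^ 2 = g ^ 2 + h ^ 2 - (c * g - s * h) ^ 2 := by
    linear_combination (g ^ 2 + h ^ 2) * hcs
  linarith [sq_nonneg (c * g - s * h)]

/-- The last equation of the blown up critical set is regular in the variables `θ`, `V`, `M₃`. -/
theorem blow_gradient_ne_zero (hb : 0 < b) (hab : b < a) (hε₀ : 0 < ε₀)
    (hε : ε₁ ^ 2 * (2 * a) < ε₀) {c s u g h V w : ℝ} (hcs : s ^ 2 + c ^ 2 = 1) (hu : u ≠ 0)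
    (hgh : g ^ 2 + h ^ 2 ≤ 2 * (a ^ 2 + b ^ 2))
    (e : V * (w + 2 * ε₁ * h) * u - V ^ 2 * (s * g + c * h)
      + u ^ 2 * (-(ε₀ * s) - ε₁ * c * w - ε₁ ^ 2 * (c * h - s * g)) = 0)
    (dV : (w + 2 * ε₁ * h) * u - 2 * V * (s * g + c * h) = 0)
    (dw : V * u - u ^ 2 * (ε₁ * c) = 0)
    (dθ : -(V ^ 2 * (c * g - s * h))
      + u ^ 2 * (-(ε₀ * c) + ε₁ * s * w + ε₁ ^ 2 * (s * h + c * g)) = 0) : False := by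
  -- The M₃-derivative determines V and the V-derivative determines M₃. The equation then forces s =
  -- 0, and the θ-derivative reduces to -ε₀cu² with c² = 1.
  have hV : V = ε₁ * c * u := by
    refine mul_left_cancel₀ hu ?_
    linear_combination dw
  have hw : w = 2 * ε₁ * c * (s * g + c * h) - 2 * ε₁ * h := by
    refine mul_left_cancel₀ hu ?_
    rw [hV] at dV
    linear_combination dV
  have hs : s = 0 := by
    have hpos : 0 < ε₀ - ε₁ ^ 2 * (s * (s * g + c * h)) := by
      refine eta_factor_pos hb hab hε hgh ?_
      have hs1 : s ^ 2 ≤ 1 := by linarith [sq_nonneg c]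
      rw [mul_pow]
      calc s ^ 2 * (s * g + c * h) ^ 2 ≤ 1 * (g ^ 2 + h ^ 2) := by
            gcongr; exact sq_rotate_le hcs g h
        _ = _ := one_mul _
    have h0 : u ^ 2 * (s * (ε₀ - ε₁ ^ 2 * (s * (s * g + c * h)))) = 0 := by
      rw [hV, hw] at e
      linear_combination -e - u ^ 2 * ε₁ ^ 2 * (s * g + c * h) * hcs
    have h1 := (mul_eq_zero.1 h0).resolve_left (pow_ne_zero 2 hu)
    exact (mul_eq_zero.1 h1).resolve_right hpos.ne'
  rw [hs] at hcs
  have hc : c ≠ 0 := by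
    intro h; rw [h] at hcs; norm_num at hcs
  have h0 : ε₀ * (c * u ^ 2) = 0 := by
    rw [hV, hs] at dθ
    linear_combination -dθ - ε₁ ^ 2 * u ^ 2 * g * c * hcs
  exact mul_ne_zero hε₀.ne' (mul_ne_zero hc (pow_ne_zero 2 hu)) h0

/-- For λ = 0 the equations read z₁² = r² > 0, |y|² + 2|z₁|² = 2(a² + b²) and, since z₁ is then
real, z₁U = 0. -/
theorem blow_exceptional (hb : 0 < b) (hab : b < a) (ht : blowEqs a b ε₀ ε₁ t = 0)
    (h1 : t 1 = 0) :
    t 2 ≠ 0 ∧ t 3 = 0 ∧ t 4 ^ 2 + t 5 ^ 2 = 4 * b ^ 2 ∧ t 6 = 0 := by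
  obtain ⟨e1, e2, e3, e4, e5⟩ := blowEqs_eq_zero_iff.1 ht
  rw [h1] at e1 e2 e3 e4
  have h2 : t 2 ≠ 0 := by
    intro h; rw [h] at e1; nlinarith [sq_nonneg (t 3)]
  have h3 : t 3 = 0 := by
    have : 2 * t 2 * t 3 = 0 := by linarith
    simpa [h2] using this
  rw [h3] at e1 e3 e4
  refine ⟨h2, h3, by linarith, ?_⟩
  have : t 2 * t 6 = 0 := by linarith
  simpa [h2] using this

theorem surjective_fderiv_blowFns (hb : 0 < b) (hab : b < a) (hε₀ : 0 < ε₀)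
    (hε : ε₁ ^ 2 * (2 * a) < ε₀) (ht : blowEqs a b ε₀ ε₁ t = 0) (h1 : t 1 = 0) :
    Function.Surjective (fderiv ℝ (fun s i => blowFns a b ε₀ ε₁ i s) t) := by
  obtain ⟨h2, h3, hgh, -⟩ := blow_exceptional hb hab ht h1
  have hfd := fun v i => fderiv_blowFns (a := a) (b := b) (ε₀ := ε₀) (ε₁ := ε₁) h1 h3 v i
  have hlast : ∃ v : Fin 9 → ℝ, (∀ i, i ∈ ({1, 2, 3, 4, 5, 6} : Set (Fin 9)) → v i = 0) ∧
      fderiv ℝ (blowFns a b ε₀ ε₁ 5) t v ≠ 0 := by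
    by_contra! hcon
    have d0 := hcon ![1, 0, 0, 0, 0, 0, 0, 0, 0] (by simp)
    have d7 := hcon ![0, 0, 0, 0, 0, 0, 0, 1, 0] (by simp)
    have d8 := hcon ![0, 0, 0, 0, 0, 0, 0, 0, 1] (by simp)
    rw [hfd] at d0 d7 d8
    simp only [Matrix.cons_val] at d0 d7 d8
    obtain ⟨-, -, -, -, e5⟩ := blowEqs_eq_zero_iff.1 ht
    refine blow_gradient_ne_zero hb hab hε₀ hε (sin_sq_add_cos_sq (t 0)) h2
      (g := t 4) (h := t 5) (by nlinarith) e5 ?_ ?_ ?_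
    · linear_combination d7
    · linear_combination d8
    · linear_combination d0
  obtain ⟨v, hv0, hv⟩ := hlast
  have v1 := hv0 1 (by simp)
  have v2 := hv0 2 (by simp)
  have v3 := hv0 3 (by simp)
  have v4 := hv0 4 (by simp)
  have v5 := hv0 5 (by simp)
  have v6 := hv0 6 (by simp)
  -- The directions are λ, Re z₁, Im z₁, radial in y, U, and a combination `v` of θ, V, M₃. On λ = 0
  -- the first five differentials vanish on `v`.
  refine surjective_fderiv_of_triangular
    (fun i => ((contDiff_blowFns i).differentiable (by simp)).differentiableAt)
    ![![0, 1, 0, 0, 0, 0, 0, 0, 0], ![0, 0, 1, 0, 0, 0, 0, 0, 0], ![0, 0, 0, 1, 0, 0, 0, 0, 0],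
      ![0, 0, 0, 0, t 4, t 5, 0, 0, 0], ![0, 0, 0, 0, 0, 0, 1, 0, 0], v] ?_ ?_
  · intro i
    by_cases hi : i = 5
    · subst hi; exact hv
    rw [hfd]
    have hgh' : 2 * t 4 * t 4 + 2 * t 5 * t 5 ≠ 0 := by nlinarith
    fin_cases i
    · simp
    · simpa using h2
    · simpa using h2
    · simpa using hgh'
    · simpa using h2
    · exact absurd rfl hi
  · intro i j hij
    rw [hfd]
    fin_cases j <;> fin_cases i <;>
      first
      | exact absurd hij (by decide)
      | simp [v1, v2, v3, v4, v5, v6]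

end blowDeriv

/-! ### Charts at points with x₁ = 0 -/

section exceptional

variable {a b ε₀ ε₁ θ : ℝ} {t : Fin 9 → ℝ} {q : V9}

/-- At λ = 0 the map formed by λ and the five equations is a submersion, hence open: near `t` it
takes values (r, 0, …, 0) with r ≠ 0, which give points of the regular part. -/
theorem blowPoint_mem_M2 (hb : 0 < b) (hab : b < a) (hε₀ : 0 < ε₀)
    (hε : ε₁ ^ 2 * (2 * a) < ε₀) (ht : blowEqs a b ε₀ ε₁ t = 0) (h2 : t 2 ≠ 0) :
    blowPoint ε₁ t ∈ M2 a b ε₀ ε₁ := by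
  rw [M2_eq_closure_regularPart]
  by_cases h1 : t 1 = 0
  swap
  · exact subset_closure (blowPoint_mem_regularPart ht h1 h2)
  set Γ : (Fin 9 → ℝ) → (Fin 6 → ℝ) := fun s i => blowFns a b ε₀ ε₁ i s with hΓ
  have hΓ0 : Γ t = 0 := by
    funext i
    exact Fin.cases h1 (fun j => congrFun ht j) i
  have hΓc : ContDiff ℝ ∞ Γ := contDiff_pi.2 fun i => contDiff_blowFns i
  have hmap : Filter.map Γ (𝓝 t) = 𝓝 (Γ t) :=
    (hΓc.contDiffAt.hasStrictFDerivAt (by simp)).map_nhds_eq_of_surj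
      (LinearMap.range_eq_top.2 (surjective_fderiv_blowFns hb hab hε₀ hε ht h1))
  rw [mem_closure_iff_frequently]
  refine (contDiff_blowPoint.continuous.tendsto t).frequently ?_
  intro hev
  have hu : ∀ᶠ s in 𝓝 t, s 2 ≠ 0 :=
    (continuous_apply (2 : Fin 9)).continuousAt.eventually_ne h2
  have himg := Filter.image_mem_map (m := Γ) (hev.and hu)
  rw [hmap, hΓ0] at himg
  have hline : Filter.Tendsto (fun r : ℝ => (Fin.cons r 0 : Fin 6 → ℝ)) (𝓝[≠] 0) (𝓝 0) := by
    have hc : Continuous (fun r : ℝ => (Fin.cons r 0 : Fin 6 → ℝ)) := by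
      refine continuous_pi fun i => ?_
      refine Fin.cases ?_ (fun j => ?_) i
      · exact continuous_id
      · exact continuous_const
    have h0 : (Fin.cons (0 : ℝ) 0 : Fin 6 → ℝ) = 0 := by
      funext i
      exact Fin.cases rfl (fun _ => rfl) i
    have := (hc.tendsto 0).mono_left (nhdsWithin_le_nhds (s := {0}ᶜ))
    rwa [h0] at this
  obtain ⟨r, ⟨s, ⟨hs, hs2⟩, hsr⟩, hr⟩ :=
    ((hline.eventually himg).and self_mem_nhdsWithin).exists
  refine hs (blowPoint_mem_regularPart ?_ ?_ hs2)
  · funext j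
    exact congrFun hsr j.succ
  · have : s 1 = r := congrFun hsr 0
    rw [this]
    exact hr

/-- `(θ, q)` lies in the blown up critical set. -/
def IsBlowUp (a b ε₀ ε₁ θ : ℝ) (q : V9) : Prop :=
  cos θ * xIm q = sin θ * xRe q ∧ blowEqs a b ε₀ ε₁ (blowCoord ε₁ θ q) = 0

theorem continuous_blowCoord : Continuous fun r : ℝ × V9 => blowCoord ε₁ r.1 r.2 := by
  unfold blowCoord yRe yIm xRe xIm mom al be
  refine continuous_pi ?_
  simp only [Fin.forall_fin_succ, IsEmpty.forall_iff, and_true,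
      Matrix.cons_val_zero, Matrix.cons_val_succ]
  refine ⟨?_, ?_, ?_, ?_, ?_, ?_, ?_, ?_, ?_⟩ <;> fun_prop

theorem isClosed_isBlowUp : IsClosed {r : ℝ × V9 | IsBlowUp a b ε₀ ε₁ r.1 r.2} := by
  have h1 := continuous_xRe
  have h2 := continuous_xIm
  refine (isClosed_eq ?_ ?_).inter (isClosed_eq ?_ continuous_const)
  · fun_prop
  · fun_prop
  · exact contDiff_blowEqs.continuous.comp continuous_blowCoord

/-- The values of the angle are taken from an interval of length `π`. -/
theorem isClosed_image_snd (θ : ℝ) {C : Set (ℝ × V9)} (hC : IsClosed C) :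
    IsClosed {q | ∃ τ ∈ Set.Icc (θ - π / 2) (θ + π / 2), (τ, q) ∈ C} := by
  have h := isClosedMap_snd_of_compactSpace (X := Set.Icc (θ - π / 2) (θ + π / 2)) (Y := V9) _
    (hC.preimage (f := fun r : Set.Icc (θ - π / 2) (θ + π / 2) × V9 => ((r.1 : ℝ), r.2))
      (by fun_prop))
  convert h using 1
  ext q
  constructor
  · rintro ⟨τ, hτ, hq⟩
    exact ⟨(⟨τ, hτ⟩, q), hq, rfl⟩
  · rintro ⟨⟨⟨τ, hτ⟩, q'⟩, hq, rfl⟩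
    exact ⟨τ, hτ, hq⟩

/-- Only the line through (x, y) matters, so the argument may be shifted by multiples of π. -/
theorem exists_angle (θ x y : ℝ) :
    ∃ τ ∈ Set.Icc (θ - π / 2) (θ + π / 2), cos τ * y = sin τ * x := by
  obtain ⟨m, hm, -⟩ := existsUnique_add_zsmul_mem_Ico pi_pos (Complex.arg ⟨x, y⟩) (θ - π / 2)
  refine ⟨_, ⟨hm.1, by linarith [hm.2]⟩, ?_⟩
  set φ := Complex.arg ⟨x, y⟩ with hφ
  have hx : ‖(⟨x, y⟩ : ℂ)‖ * cos φ = x := Complex.norm_mul_cos_arg _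
  have hy : ‖(⟨x, y⟩ : ℂ)‖ * sin φ = y := Complex.norm_mul_sin_arg _
  have h1 := sin_sub φ (φ + m • π)
  have h2 : sin (φ - (φ + m • π)) = 0 := by
    rw [sub_add_cancel_left, sin_neg, zsmul_eq_mul, sin_int_mul_pi, neg_zero]
  rw [h2] at h1
  linear_combination -‖(⟨x, y⟩ : ℂ)‖ * h1 + sin (φ + m • π) * hx - cos (φ + m • π) * hy

/-- Regular points lift to the blow-up, and compactness of the angle interval makes the projection
closed, so limits lift too. -/
theorem exists_isBlowUp_of_mem_M2 (θ : ℝ) (hq : q ∈ M2 a b ε₀ ε₁) :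
    ∃ τ ∈ Set.Icc (θ - π / 2) (θ + π / 2), IsBlowUp a b ε₀ ε₁ τ q := by
  rw [M2_eq_closure_regularPart] at hq
  refine closure_minimal ?_ (isClosed_image_snd θ isClosed_isBlowUp) hq
  intro q hq
  obtain ⟨τ, hτ, h⟩ := exists_angle θ (xRe q) (xIm q)
  exact ⟨τ, hτ, h, blowEqs_blowCoord hq h⟩

theorem eq_of_sin_sub_eq_zero {τ : ℝ} (hτ : τ ∈ Set.Icc (θ - π / 2) (θ + π / 2))
    (h : sin (τ - θ) = 0) : τ = θ := by
  have := pi_pos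
  have := (sin_eq_zero_iff_of_lt_of_lt (by linarith [hτ.1]) (by linarith [hτ.2])).1 h
  linarith

theorem eq_zero_of_sq_add_sq_eq_zero {x y : ℝ} (h : x ^ 2 + y ^ 2 = 0) : x = 0 ∧ y = 0 := by
  rw [add_eq_zero_iff_of_nonneg (sq_nonneg x) (sq_nonneg y)] at h
  simpa using h

/-- Over a point with `x₁ = 0` the direction of the blow-up is determined up to sign. -/
theorem isBlowUp_angle_unique (hb : 0 < b) (hab : b < a) (hε : ε₁ ^ 2 * (2 * a) < ε₀) {τ : ℝ}
    (hτ : τ ∈ Set.Icc (θ - π / 2) (θ + π / 2)) (hx : xNormSq q = 0)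
    (hθq : IsBlowUp a b ε₀ ε₁ θ q) (hτq : IsBlowUp a b ε₀ ε₁ τ q) : τ = θ := by
  have hx' : xRe q = 0 ∧ xIm q = 0 := eq_zero_of_sq_add_sq_eq_zero hx
  have hl : ∀ φ, blowCoord ε₁ φ q 1 = 0 := fun φ => by
    simp [blowCoord, hx'.1, hx'.2]
  obtain ⟨u0, -, hgh, A⟩ := blow_exceptional hb hab hθq.2 (hl θ)
  obtain ⟨-, -, -, B⟩ := blow_exceptional hb hab hτq.2 (hl τ)
  obtain ⟨-, -, -, -, C⟩ := blowEqs_eq_zero_iff.1 hθq.2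
  obtain ⟨-, -, -, -, D⟩ := blowEqs_eq_zero_iff.1 hτq.2
  simp only [blowCoord, etaIm, Matrix.cons_val] at A B C D u0 hgh
  set n1 := mom q 0 / 2 - ε₁ * be q 2
  set n2 := mom q 1 / 2 + ε₁ * al q 2
  refine eq_of_sin_sub_eq_zero hτ ?_
  rw [sin_sub]
  -- Here n = w₁ + iε₁z₁. If n ≠ 0, U = 0 makes both directions orthogonal to n. If n = 0, then V =
  -- 0 and the last equation says that both directions are parallel to η, whose real part is
  -- positive.
  by_cases hn : n1 = 0 ∧ n2 = 0
  · rw [hn.1, hn.2] at C D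
    have hη : 0 < ε₀ - ε₁ ^ 2 * yRe q := by
      refine eta_factor_pos hb hab hε (g := yRe q) (h := yIm q) (by nlinarith) ?_
      linarith [sq_nonneg (yIm q)]
    refine (mul_eq_zero.1 (?_ : (al q 2 ^ 2 * (ε₀ - ε₁ ^ 2 * yRe q)) * _ = 0)).resolve_left
      (mul_ne_zero (pow_ne_zero 2 u0) hη.ne')
    linear_combination cos τ * C - cos θ * D
  · have hpos : n1 ^ 2 + n2 ^ 2 ≠ 0 := fun h => hn (eq_zero_of_sq_add_sq_eq_zero h)
    refine (mul_eq_zero.1 (?_ : (n1 ^ 2 + n2 ^ 2) * _ = 0)).resolve_left hpos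
    linear_combination (sin τ * n1 - cos τ * n2) * A + (cos θ * n2 - sin θ * n1) * B

theorem hasDerivAt_comp_line_of_fderiv_eq_zero {X E : Type*} [NormedAddCommGroup X]
    [NormedSpace ℝ X] [NormedAddCommGroup E] [NormedSpace ℝ E] {Ψ : X → E} {p v : X}
    (hΨ : DifferentiableAt ℝ Ψ p) (hv : fderiv ℝ Ψ p v = 0) {f : E → ℝ}
    (hf : Differentiable ℝ f) : HasDerivAt (fun s : ℝ => f (Ψ (p + s • v))) 0 0 := by
  have h := ((hf (Ψ p)).hasFDerivAt.comp p hΨ.hasFDerivAt).hasLineDerivAt v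
  simpa [HasLineDerivAt, hv] using h

theorem fderiv_blowPoint_injective_on_ker (hb : 0 < b) (hab : b < a)
    (hε : ε₁ ^ 2 * (2 * a) < ε₀) (ht : blowEqs a b ε₀ ε₁ t = 0) (h1 : t 1 = 0) {v : Fin 9 → ℝ}
    (hG : ∀ i, fderiv ℝ (blowFns a b ε₀ ε₁ (Fin.succ i)) t v = 0)
    (hπ : fderiv ℝ (blowPoint ε₁) t v = 0) : v = 0 := by
  obtain ⟨h2, h3, hgh, h6⟩ := blow_exceptional hb hab ht h1
  have hcs := sin_sq_add_cos_sq (t 0)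
  have hd : ∀ {f : V9 → ℝ}, Differentiable ℝ f →
      HasDerivAt (fun s : ℝ => f (blowPoint ε₁ (t + s • v))) 0 0 := fun hf =>
    hasDerivAt_comp_line_of_fderiv_eq_zero
      (contDiff_blowPoint.differentiable (by simp)).differentiableAt hπ hf
  have h := hasDerivAt_line_apply t v
  have hc := (h 0).cos
  have hs := (h 0).sin
  have dx1 : v 1 * cos (t 0) = 0 := by
    have k := hd (f := xRe) (by unfold xRe al be; fun_prop)
    simp only [xRe_blowPoint] at k
    simpa [h1] using ((h 1).fun_mul hc).unique k
  have dx2 : v 1 * sin (t 0) = 0 := by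
    have k := hd (f := xIm) (by unfold xIm al be; fun_prop)
    simp only [xIm_blowPoint] at k
    simpa [h1] using ((h 1).fun_mul hs).unique k
  have v1 : v 1 = 0 := by
    linear_combination cos (t 0) * dx1 + sin (t 0) * dx2 - v 1 * hcs
  have v2 : v 2 = 0 := (h 2).unique (hd (f := fun q => al q 2) (by unfold al; fun_prop))
  have v3 : v 3 = 0 := (h 3).unique (hd (f := fun q => be q 2) (by unfold be; fun_prop))
  have v4 : v 4 = 0 := by
    have k := hd (f := yRe) (by unfold yRe al be; fun_prop)
    simp only [yRe_blowPoint] at k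
    exact (h 4).unique k
  have v5 : v 5 = 0 := by
    have k := hd (f := yIm) (by unfold yIm al be; fun_prop)
    simp only [yIm_blowPoint] at k
    exact (h 5).unique k
  have v8 : v 8 = 0 := (h 8).unique (hd (f := fun q => mom q 2) (by unfold mom; fun_prop))
  have v6 : v 6 = 0 := by
    have k := hG 3
    rw [fderiv_blowFns h1 h3] at k
    simpa [v1, v2, v3, h2] using k
  have dw1 : -(sin (t 0) * v 0 * t 6) + cos (t 0) * v 6
      - (cos (t 0) * v 0 * t 7 + sin (t 0) * v 7) + ε₁ * v 3 = 0 := by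
    have k := hd (f := fun q => mom q 0) (by unfold mom; fun_prop)
    simp only [mom, blowPoint, Matrix.cons_val] at k
    have k' := ((((hc.fun_mul (h 6)).fun_sub (hs.fun_mul (h 7))).fun_add
      ((h 3).const_mul ε₁)).const_mul 2).unique k
    simp at k'
    linear_combination k'
  have dw2 : cos (t 0) * v 0 * t 6 + sin (t 0) * v 6
      + (-(sin (t 0) * v 0 * t 7) + cos (t 0) * v 7) - ε₁ * v 2 = 0 := by
    have k := hd (f := fun q => mom q 1) (by unfold mom; fun_prop)
    simp only [mom, blowPoint, Matrix.cons_val] at k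
    have k' := ((((hs.fun_mul (h 6)).fun_add (hc.fun_mul (h 7))).fun_sub
      ((h 2).const_mul ε₁)).const_mul 2).unique k
    simp at k'
    linear_combination k'
  rw [h6, v6, v3] at dw1
  rw [h6, v6, v2] at dw2
  have v7 : v 7 = 0 := by
    linear_combination cos (t 0) * dw2 - sin (t 0) * dw1 - v 7 * hcs
  have v07 : v 0 * t 7 = 0 := by
    linear_combination -cos (t 0) * dw1 - sin (t 0) * dw2 - v 0 * t 7 * hcs
  -- If V = 0, the last equation and its θ-derivative give the imaginary and real parts of exp(-iθ)η
  -- up to nonzero factors; both cannot vanish.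
  have v0 : v 0 = 0 := by
    by_contra hv0
    have t7 : t 7 = 0 := (mul_eq_zero.1 v07).resolve_left hv0
    have k := hG 4
    rw [fderiv_blowFns h1 h3] at k
    have k5 := (blowEqs_eq_zero_iff.1 ht).2.2.2.2
    simp [v2, v4, v5, v7, v8, t7, h2, hv0] at k
    simp [t7, h2, etaIm] at k5
    have hη : 0 < ε₀ - ε₁ ^ 2 * t 4 := by
      refine eta_factor_pos hb hab hε (g := t 4) (h := t 5) (by nlinarith) ?_
      linarith [sq_nonneg (t 5)]
    refine hη.ne' ?_
    linear_combination -cos (t 0) * k - sin (t 0) * k5 - (ε₀ - ε₁ ^ 2 * t 4) * hcs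
  ext i
  fin_cases i
  exacts [v0, v1, v2, v3, v4, v5, v6, v7, v8]

theorem exists_chart_exceptional (hb : 0 < b) (hab : b < a) (hε₀ : 0 < ε₀)
    (hε : ε₁ ^ 2 * (2 * a) < ε₀) (hq : q ∈ M2 a b ε₀ ε₁) (hx : xNormSq q = 0) :
    ∃ (U : Set V9) (V : Set (Fin 4 → ℝ)) (φ : (Fin 4 → ℝ) → V9) (ψ : V9 → (Fin 4 → ℝ)),
      IsOpen U ∧ q ∈ U ∧ IsOpen V ∧ ContDiffOn ℝ ∞ φ V ∧ ContDiffOn ℝ ∞ ψ U ∧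
      φ '' V = M2 a b ε₀ ε₁ ∩ U ∧ ∀ v ∈ V, ψ (φ v) = v := by
  obtain ⟨θ, -, hθ⟩ := exists_isBlowUp_of_mem_M2 0 hq
  set t := blowCoord ε₁ θ q with ht
  have hinv : blowPoint ε₁ t = q := blowPoint_blowCoord hθ.1
  have h1 : t 1 = 0 := by
    have := xNormSq_blowPoint (ε₁ := ε₁) (t := t)
    rw [hinv, hx] at this
    simpa using this.symm
  obtain ⟨h2, -⟩ := blow_exceptional hb hab hθ.2 h1
  have hO : IsOpen {s : Fin 9 → ℝ | s 2 ≠ 0} :=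
    isOpen_ne_fun (continuous_apply _) continuous_const
  have hfd : fderiv ℝ (blowEqs a b ε₀ ε₁) t = ContinuousLinearMap.pi fun i =>
      fderiv ℝ (blowFns a b ε₀ ε₁ (Fin.succ i)) t :=
    fderiv_pi fun i => ((contDiff_blowFns i.succ).differentiable (by simp)).differentiableAt
  have key := exists_chart_of_levelSet (k := 4) (S := M2 a b ε₀ ε₁) (Ψ := blowPoint ε₁)
    hO h2 (contDiff_blowEqs (a := a) (b := b) (ε₀ := ε₀) (ε₁ := ε₁)).contDiffOn
    contDiff_blowPoint.contDiffOn ?_ ?_ (by simp) ?_ ?_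
  · rwa [hinv] at key
  · intro y
    obtain ⟨v, hv⟩ := surjective_fderiv_blowFns hb hab hε₀ hε hθ.2 h1 (Fin.cons 0 y)
    rw [fderiv_pi fun i =>
      ((contDiff_blowFns i).differentiable (by simp)).differentiableAt] at hv
    refine ⟨v, ?_⟩
    rw [hfd]
    ext i
    exact congrFun hv i.succ
  · intro v hv hv'
    rw [hfd] at hv
    exact fderiv_blowPoint_injective_on_ker hb hab hε hθ.2 h1 (fun i => congrFun hv i) hv'
  · exact fun s hs h0 => blowPoint_mem_M2 hb hab hε₀ hε h0 hs
  · intro O' hO'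
    rw [hinv]
    -- Lifts with coordinates outside the interior of `O'` project to a closed set, which misses `q`
    -- by uniqueness of the angle. Its complement is the required neighbourhood.
    have hC : IsClosed ({r : ℝ × V9 | IsBlowUp a b ε₀ ε₁ r.1 r.2} ∩
        (fun r : ℝ × V9 => blowCoord ε₁ r.1 r.2) ⁻¹' (interior O')ᶜ) :=
      isClosed_isBlowUp.inter (isOpen_interior.isClosed_compl.preimage continuous_blowCoord)
    refine ⟨_, (isClosed_image_snd θ hC).isOpen_compl.mem_nhds ?_, ?_⟩
    · rintro ⟨τ, hτ, hτq, hτO⟩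
      have := isBlowUp_angle_unique hb hab hε hτ hx hθ hτq
      subst this
      exact hτO (mem_interior_iff_mem_nhds.2 hO')
    · rintro q' ⟨hq', hq'U⟩
      obtain ⟨τ, hτ, hτq⟩ := exists_isBlowUp_of_mem_M2 θ hq'
      refine ⟨blowCoord ε₁ τ q', ⟨?_, hτq.2⟩, blowPoint_blowCoord hτq.1⟩
      by_contra hcon
      exact hq'U ⟨τ, hτ, hτq, fun h => hcon (interior_subset h)⟩

theorem M2_nonempty (hb : 0 < b) (hab : b < a) : (M2 a b ε₀ ε₁).Nonempty := by
  rw [M2_eq_closure_regularPart]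
  refine ⟨(0, ![a, 0, 0], ![0, -b, 0]), subset_closure ⟨⟨?_, ?_, ?_⟩, ?_, ?_, ?_⟩⟩
  · simp [al, dotProduct, Fin.sum_univ_three]; ring
  · simp [be, dotProduct, Fin.sum_univ_three]; ring
  · simp [al, be, dotProduct, Fin.sum_univ_three]
  · have : a + b ≠ 0 := by linarith
    simpa [xNormSq, xRe, xIm, al, be] using this
  · simp [EqF, xNormSq, xRe, xIm, al, be, mom]
  · simp [EqF₁, pCoord, qCoord, xNormSq, xRe, xIm, al, be, mom]

end exceptional

end

end GTFG

theorem proposition3 (a b ε₀ : ℝ) (hb : 0 < b) (hab : b < a) (hε₀ : 0 < ε₀) :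
    ∃ δ : ℝ, 0 < δ ∧ ∀ ε₁ : ℝ, |ε₁| < δ →
      (GTFG.M2 a b ε₀ ε₁).Nonempty ∧ GTFG.IsSmoothSubmanifold 4 (GTFG.M2 a b ε₀ ε₁) := by
  have ha : 0 < a := hb.trans hab
  -- This δ makes |ε₁| < δ equivalent to 2aε₁² < ε₀.
  refine ⟨Real.sqrt (ε₀ / (2 * a)), Real.sqrt_pos.2 (by positivity), fun ε₁ hε₁ => ?_⟩
  have hε : ε₁ ^ 2 * (2 * a) < ε₀ := by
    have h := (Real.lt_sqrt (abs_nonneg ε₁)).1 hε₁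
    rwa [sq_abs, lt_div_iff₀ (by positivity)] at h
  refine ⟨GTFG.M2_nonempty hb hab, fun q hq => ?_⟩
  by_cases hx : GTFG.xNormSq q = 0
  · exact GTFG.exists_chart_exceptional hb hab hε₀ hε hq hx
  · exact GTFG.exists_chart_regular hb hab hε₀ hε hq hx
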